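/- **Setting.** Let $A_i\in\mathbb{R}^{d\times d}$, $B_i\in\mathbb{R}^{d\times k}$, $Q_i\succ0$, $R_i\succ 0$ ($i=1,\dots,N$), and let $(\omega(t))_{t\ge 0}$ be a time-homogeneous Markov chain on $\{1,\dots,N\}$ with transition probabilities $p_{ij}$ and initial distribution $\pi$, $\pi_i>0$ for all $i$. Let $x_0$ be a random vector in $\mathbb{R}^d$ with finite second moments, independent of $(\omega(t))$, with $\mathbb{E}[x_0x_0^T]\succ0$. For a tuple $K=(K_1,\dots,K_N)$ of real $k\times d$ matrices consider the closed loop $x_{t+1}=(A_{\omega(t)}-B_{\omega(t)}K_{\omega(t)})x_t$, $u_t=-K_{\omega(t)}x_t$. Let $\mathbb{K}$ be the set of all $K$ for which it is mean-square stable, i.e. $\mathbb{E}[x_tx_t^T]\to0$ for every deterministic initial state and every initial mode; assume $\mathbb{K}\neq\emptyset$. On tuples use $\langle V,W\rangle=\sum_i \operatorname{tr}(V_i^TW_i)$ and $\|V\|_2=\langle V,V\rangle^{1/2}$; products, transposes and inverses of tuples are taken componentwise. Put $$C(K)=\mathbb{E}\sum_{t\ge0}\big(x_t^TQ_{\omega(t)}x_t+u_t^TR_{\omega(t)}u_t\big),\qquad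 \mathbf{X}^K_i=\sum_{t\ge0}\mathbb{E}\big[x_tx_t^T\mathbf 1\{\omega(t)=i\}\big],\qquad \mathcal{E}_i(V)=\sum_j p_{ij}V_j,$$ let $\nabla C$ be the gradient with respect to $\langle\cdot,\cdot\rangle$, let $P^K=\sum_{t\ge0}(\mathcal{L}^K)^t(Q+K^TRK)$ with $\mathcal{L}^K_i(V)=(A_i-B_iK_i)^T\mathcal{E}_i(V)(A_i-B_iK_i)$ (for $K\in\mathbb{K}$ the solution of the coupled Lyapunov equations $P^K=Q+K^TRK+\mathcal{L}^K(P^K)$), and let $L^K=(R+B^T\mathcal{E}(P^K)B)K-B^T\mathcal{E}(P^K)A$. **Theorem (ODE limits).** The coupled algebraic Riccati equations $$P=Q+A^T\mathcal{E}(P)A-A^T\mathcal{E}(P)B\,(R+B^T\mathcal{E}(P)B)^{-1}B^T\mathcal{E}(P)A$$ have a unique positive definite solution $P$. The controller $K^*=(R+B^T\mathcal{E}(P)B)^{-1}B^T\mathcal{E}(P)A$ lies in $\mathbb{K}$ and is the unique minimizer of $C$ over $\mathbb{K}$. Moreover, for each of the three flows - gradient flow: $\dot K=-\nabla C(K)$,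 - Gauss–Newton flow: $\dot K=-2(R+B^T\mathcal{E}(P^K)B)^{-1}L^K$, - natural gradient flow: $\dot K=-\nabla C(K)(\mathbf{X}^K)^{-1}$, there is a rate $c>0$, not depending on the initial point, such that for every $K^0\in\mathbb{K}$ there is a trajectory $K(t)\in\mathbb{K}$ of the flow, defined for all $t\ge0$, with $K(0)=K^0$. It agrees on $[0,T)$ with any solution in $\mathbb{K}$ that starts at $K^0$ and is defined on $[0,T)$, and it converges exponentially to $K^*$: for all $t\ge0$, $$C(K(t))-C(K^*)\le e^{-ct}\big(C(K^0)-C(K^*)\big)\qquad\text{and}\qquad \|K(t)-K^*\|_2\le M e^{-ct},$$ where the constant $M$ may depend on $K^0$. -/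

import Mathlib

open MeasureTheory ProbabilityTheory Filter Topology Set
open scoped ENNReal Matrix

noncomputable section

/-- Data of the Markovian jump LQ problem with `d` states, `k` inputs and `N` modes: system matrices
`A i`, `B i`, cost matrices `Q i`, `R i`, transition matrix `p`, initial mode distribution `π₀`,
and, on a measurable space `S`, a measure `Pr`, the mode process `ω` and the initial state `x₀`. -/
structure MJLS (d k N : ℕ) (S : Type*) [MeasurableSpace S] where
  A : Fin N → Matrix (Fin d) (Fin d) ℝ
  B : Fin N → Matrix (Fin d) (Fin k) ℝ
  Q : Fin N → Matrix (Fin d) (Fin d) ℝ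
  R : Fin N → Matrix (Fin k) (Fin k) ℝ
  p : Matrix (Fin N) (Fin N) ℝ
  π₀ : Fin N → ℝ
  Pr : Measure S
  ω : ℕ → S → Fin N
  x₀ : S → Fin d → ℝ

/-- `ω` is a time-homogeneous Markov chain under `Pr`, with transition matrix `p` and initial
distribution `π₀`. The field `step` is the Markov property
`P(ω(t+1) = h(t+1) | ω(0) = h(0), …, ω(t) = h(t)) = p (h t) (h (t+1))`, cleared of its
denominator. -/
structure IsMarkovChain {N : ℕ} {S : Type*} [MeasurableSpace S] (Pr : Measure S)
    (ω : ℕ → S → Fin N) (p : Matrix (Fin N) (Fin N) ℝ) (π₀ : Fin N → ℝ) : Prop where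
  measurable : ∀ t, Measurable (ω t)
  p_nonneg : ∀ i j, 0 ≤ p i j
  p_sum : ∀ i, ∑ j, p i j = 1
  init : ∀ i, Pr.real {s | ω 0 s = i} = π₀ i
  step : ∀ (t : ℕ) (h : ℕ → Fin N),
    Pr.real {s | ∀ l ≤ t + 1, ω l s = h l} =
      Pr.real {s | ∀ l ≤ t, ω l s = h l} * p (h t) (h (t + 1))

/-- Tuples `K = (K₁, …, K_N)` of real `k × d` matrices, with the Frobenius inner product
`⟪K, K'⟫ = ∑ᵢ tr (Kᵢᵀ K'ᵢ)` and the norm that it induces. -/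
abbrev Gain (d k N : ℕ) : Type := EuclideanSpace ℝ (Fin N × Fin k × Fin d)

/-- The `i`-th matrix of a tuple. -/
def Gain.mat {d k N : ℕ} (K : Gain d k N) (i : Fin N) : Matrix (Fin k) (Fin d) ℝ :=
  Matrix.of fun a b => K (i, a, b)

/-- The tuple with given matrices. -/
def Gain.ofMat {d k N : ℕ} (M : Fin N → Matrix (Fin k) (Fin d) ℝ) : Gain d k N :=
  WithLp.toLp 2 fun q => M q.1 q.2.1 q.2.2

/-- The matrix `E[y yᵀ]` of second moments of a random vector `y`. -/
def secondMoment {d : ℕ} {S : Type*} [MeasurableSpace S] (μ : Measure S) (y : S → Fin d → ℝ) :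
    Matrix (Fin d) (Fin d) ℝ :=
  Matrix.of fun a b => ∫ s, y s a * y s b ∂μ

namespace MJLS

variable {d k N : ℕ} {S : Type*} [MeasurableSpace S] (sys : MJLS d k N S)

/-- The closed-loop matrices `Γᵢ = Aᵢ - Bᵢ Kᵢ`. -/
def closedLoop (K : Gain d k N) (i : Fin N) : Matrix (Fin d) (Fin d) ℝ :=
  sys.A i - sys.B i * K.mat i

/-- The closed-loop state at time `t` when the initial state is `v` and the modes are `w`:
`x_{t+1} = A_{w t} x_t + B_{w t} u_t` with `u_t = - K_{w t} x_t`. -/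
def state (K : Gain d k N) (w : ℕ → Fin N) (v : Fin d → ℝ) : ℕ → Fin d → ℝ
  | 0 => v
  | t + 1 => sys.closedLoop K (w t) *ᵥ state K w v t

/-- The closed-loop state process, started at the random initial state. -/
def x (K : Gain d k N) (t : ℕ) (s : S) : Fin d → ℝ :=
  sys.state K (fun l => sys.ω l s) (sys.x₀ s) t

/-- The input process `u_t = - K_{ω(t)} x_t`. -/
def u (K : Gain d k N) (t : ℕ) (s : S) : Fin k → ℝ :=
  -(K.mat (sys.ω t s) *ᵥ sys.x K t s)

/-- The set of gains for which the closed loop is mean-square stable: for every deterministic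
initial state `v` and every initial mode `i`, `E[x_t x_tᵀ] → 0`. -/
def stabilizing : Set (Gain d k N) :=
  {K | ∀ (v : Fin d → ℝ) (i : Fin N),
    Tendsto (fun t : ℕ => secondMoment (ProbabilityTheory.cond sys.Pr {s | sys.ω 0 s = i})
      (fun s => sys.state K (fun l => sys.ω l s) v t)) atTop (𝓝 0)}

/-- The cost `C(K) = E[∑ₜ x_tᵀ Q_{ω(t)} x_t + u_tᵀ R_{ω(t)} u_t]`, with values in `[0, ∞]`. -/
def cost (K : Gain d k N) : ℝ≥0∞ :=
  ∫⁻ s, ∑' t : ℕ, ENNReal.ofReal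
    (sys.x K t s ⬝ᵥ (sys.Q (sys.ω t s) *ᵥ sys.x K t s) +
      sys.u K t s ⬝ᵥ (sys.R (sys.ω t s) *ᵥ sys.u K t s)) ∂sys.Pr

/-- The cost as a real-valued function (used where it is finite). -/
def costReal (K : Gain d k N) : ℝ := (sys.cost K).toReal

/-- `ℰᵢ(V) = ∑ⱼ pᵢⱼ Vⱼ`. -/
def expOp (V : Fin N → Matrix (Fin d) (Fin d) ℝ) (i : Fin N) : Matrix (Fin d) (Fin d) ℝ :=
  ∑ j, sys.p i j • V j

/-- `ℒᵢ(V) = Γᵢᵀ ℰᵢ(V) Γᵢ`. -/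
def lyapOp (K : Gain d k N) (V : Fin N → Matrix (Fin d) (Fin d) ℝ) :
    Fin N → Matrix (Fin d) (Fin d) ℝ :=
  fun i => (sys.closedLoop K i)ᵀ * sys.expOp V i * sys.closedLoop K i

/-- The value matrices `P^K = ∑ₜ ℒᵗ(Q + Kᵀ R K)`. For stabilizing `K` this is the solution of the
coupled Lyapunov equations `P^K = Q + Kᵀ R K + ℒ(P^K)`. -/
def valueMat (K : Gain d k N) : Fin N → Matrix (Fin d) (Fin d) ℝ :=
  ∑' t : ℕ, (sys.lyapOp K)^[t] (fun i => sys.Q i + (K.mat i)ᵀ * sys.R i * K.mat i)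

/-- The aggregate correlation matrices `𝐗ᵢ^K = ∑ₜ E[x_t x_tᵀ 1{ω(t) = i}]`. -/
def corrMat (K : Gain d k N) (i : Fin N) : Matrix (Fin d) (Fin d) ℝ :=
  ∑' t : ℕ, secondMoment (sys.Pr.restrict {s | sys.ω t s = i}) (sys.x K t)

/-- `Rᵢ + Bᵢᵀ ℰᵢ(V) Bᵢ`. -/
def psi (V : Fin N → Matrix (Fin d) (Fin d) ℝ) (i : Fin N) : Matrix (Fin k) (Fin k) ℝ :=
  sys.R i + (sys.B i)ᵀ * sys.expOp V i * sys.B i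

/-- `Lᵢ^K = (Rᵢ + Bᵢᵀ ℰᵢ(P^K) Bᵢ) Kᵢ - Bᵢᵀ ℰᵢ(P^K) Aᵢ`. -/
def lMat (K : Gain d k N) (i : Fin N) : Matrix (Fin k) (Fin d) ℝ :=
  sys.psi (sys.valueMat K) i * K.mat i - (sys.B i)ᵀ * sys.expOp (sys.valueMat K) i * sys.A i

/-- `P` is a positive definite solution of the coupled algebraic Riccati equations. -/
def IsRiccatiSolution (P : Fin N → Matrix (Fin d) (Fin d) ℝ) : Prop :=
  (∀ i, (P i).PosDef) ∧
  ∀ i, P i = sys.Q i + (sys.A i)ᵀ * sys.expOp P i * sys.A i -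
    (sys.A i)ᵀ * sys.expOp P i * sys.B i * (sys.psi P i)⁻¹ *
      ((sys.B i)ᵀ * sys.expOp P i * sys.A i)

/-- The gain `Kᵢ = (Rᵢ + Bᵢᵀ ℰᵢ(P) Bᵢ)⁻¹ Bᵢᵀ ℰᵢ(P) Aᵢ`. -/
def riccatiGain (P : Fin N → Matrix (Fin d) (Fin d) ℝ) : Gain d k N :=
  Gain.ofMat fun i => (sys.psi P i)⁻¹ * ((sys.B i)ᵀ * sys.expOp P i * sys.A i)

/-- Vector field of the gradient flow, `- ∇C(K)`. -/
def gradField (K : Gain d k N) : Gain d k N :=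
  -gradient sys.costReal K

/-- Vector field of the Gauss–Newton flow, `- 2 (R + Bᵀ ℰ(P^K) B)⁻¹ L^K`. -/
def gaussNewtonField (K : Gain d k N) : Gain d k N :=
  Gain.ofMat fun i => -((2 : ℝ) • ((sys.psi (sys.valueMat K) i)⁻¹ * sys.lMat K i))

/-- Vector field of the natural gradient flow, `- ∇C(K) (𝐗^K)⁻¹`. -/
def natGradField (K : Gain d k N) : Gain d k N :=
  Gain.ofMat fun i => -(Gain.mat (gradient sys.costReal K) i * (sys.corrMat K i)⁻¹)

/-- `φ` solves `φ' = F(φ)` on the time interval `J`, starts at `K₀`, and stays in the domain of the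
vector field, the set of stabilizing gains (one-sided derivative at an end point in `J`). -/
def IsTrajectory (F : Gain d k N → Gain d k N) (K₀ : Gain d k N) (J : Set ℝ)
    (φ : ℝ → Gain d k N) : Prop :=
  φ 0 = K₀ ∧ ∀ t ∈ J, φ t ∈ sys.stabilizing ∧ HasDerivWithinAt φ (F (φ t)) J t

end MJLS

end

/-! Everything rests on the positive operator ℒ^K. Splitting over mode paths and using the
independence of x₀ and ω shows that E[x_tᵀ V_{ω(t)} x_t] is the pairing of the initial correlations
with (ℒ^K)^t V (`Admissible.integral_quad`). Hence K is mean-square stable iff some power of ℒ^K has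
norm below 1 (`mem_stabilizing_iff_norm`). So 𝕂 is open, 1 - ℒ^K is invertible on it, and C, P^K and
𝐗^K are smooth there, since all of them come from (1 - ℒ^K)⁻¹.

The core is an exact formula (`Regular.costReal_sub`): with D = K' - K and Ψ = R + Bᵀℰ(P^K)B, C(K')
- C(K) = ∑ᵢ tr 𝐗ᵢ^{K'} (DᵀL^K + (L^K)ᵀD + DᵀΨD)ᵢ. Letting K' tend to K gives ∇C = 2 L^K 𝐗^K.
Completing the square with K' = K* bounds C(K) - C(K*) by a fixed multiple of ∑ᵢ tr (LᵀΨ⁻¹L)ᵢ; as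
𝐗^K dominates the positive definite initial correlations, this is gradient dominance with a constant
uniform in K (`exists_decay_rate`). Where L vanishes only the term DᵀΨD survives, which gives
quadratic growth and uniqueness (`exists_quadratic_growth`).

Sublevel sets of C are compact (`isCompact_sublevel`): a bound on C bounds P^K, and P^K is a
Lyapunov function that forces a uniform decay of (ℒ^K)^t. So a minimizer exists, L vanishes there,
and then the Lyapunov equation for P^K is the Riccati equation; conversely every positive definite
Riccati solution is the value matrix of its own gain, which is stationary.

For the flows, the cost gap decays exponentially, so a trajectory stays in a compact sublevel set,
where the field may be replaced by a globally Lipschitz one (`exists_trajectory_of_decay`).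
Quadratic growth turns the decay of the cost into decay of ‖K(t) - K*‖. -/

section ODE

/-! ### Flows that decrease a function with compact sublevel sets -/

variable {E : Type*} [NormedAddCommGroup E] [NormedSpace ℝ E]

/-- A bounded Lipschitz vector field on a Banach space has global integral curves. -/
theorem exists_global_integral_curve [CompleteSpace E] {G : E → E} {κ L : NNReal}
    (hG : LipschitzWith κ G) (hL : ∀ x, ‖G x‖ ≤ L) (x₀ : E) :
    ∃ φ : ℝ → E, φ 0 = x₀ ∧ ∀ t, HasDerivAt φ (G (φ t)) t := by
  have key : ∀ n : ℕ, ∃ α : ℝ → E, α 0 = x₀ ∧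
      ∀ t ∈ Ioo (-(n : ℝ)) n, HasDerivAt α (G (α t)) t := by
    intro n
    have h0 : (0 : ℝ) ∈ Icc (-(n : ℝ)) n := by constructor <;> simp
    -- Speed at most `L` cannot leave the ball of radius `L * n` within time `n`, so Picard–Lindelöf
    -- holds on the whole interval.
    have hpl : IsPicardLindelof (fun _ ↦ G) (⟨0, h0⟩ : Icc (-(n : ℝ)) n) x₀ (L * n) 0 L κ :=
      IsPicardLindelof.of_time_independent (fun x _ ↦ hL x) hG.lipschitzOnWith (by simp)
    obtain ⟨α, h1, h2⟩ := hpl.exists_eq_forall_mem_Icc_hasDerivWithinAt₀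
    exact ⟨α, h1, fun t ht ↦ (h2 t (Ioo_subset_Icc_self ht)).hasDerivAt (Icc_mem_nhds ht.1 ht.2)⟩
  choose α h0 hα using key
  have huniq : ∀ m n : ℕ, m ≤ n → ∀ t : ℝ, |t| < m → α m t = α n t := by
    intro m n hmn t ht
    have hm : (0 : ℝ) < m := (abs_nonneg t).trans_lt ht
    have hmn' : (m : ℝ) ≤ n := by exact_mod_cast hmn
    exact ODE_solution_unique_of_mem_Ioo (v := fun _ ↦ G) (s := fun _ ↦ univ) (K := κ)
      (a := -(m : ℝ)) (b := m) (t₀ := 0)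
      (fun _ _ ↦ hG.lipschitzOnWith) ⟨by linarith, hm⟩ (fun s hs ↦ ⟨hα m s hs, trivial⟩)
      (fun s hs ↦ ⟨hα n s ⟨by linarith [hs.1], by linarith [hs.2]⟩, trivial⟩)
      (by rw [h0, h0]) (abs_lt.1 ht)
  have hN : ∀ t : ℝ, |t| < ((⌈|t|⌉₊ + 1 : ℕ) : ℝ) := fun t ↦ by
    push_cast; linarith [Nat.le_ceil |t|]
  have hφ : ∀ (m : ℕ) (t : ℝ), |t| < m → α (⌈|t|⌉₊ + 1) t = α m t := by
    intro m t ht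
    rcases le_total m (⌈|t|⌉₊ + 1) with h | h
    · exact (huniq _ _ h t ht).symm
    · exact huniq _ _ h t (hN t)
  -- The `+ 1` puts `t` in the interior of the interval used, so the glued curve agrees with a
  -- single local solution near `t`.
  refine ⟨fun t ↦ α (⌈|t|⌉₊ + 1) t, h0 _, fun t ↦ ?_⟩
  refine (hα (⌈|t|⌉₊ + 1) t (abs_lt.1 (hN t))).congr_of_eventuallyEq ?_
  filter_upwards [Ioo_mem_nhds (abs_lt.1 (hN t)).1 (abs_lt.1 (hN t)).2] with s hs
  exact hφ _ s (abs_lt.2 hs)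

/-- Along integral curves of a field `v` for which `f - m` decays at rate `c`, the function
`exp (c t) (f - m)` is antitone. -/
theorem antitoneOn_exp_mul_along {U : Set E} {v : E → E} {f : E → ℝ} {f' : E → E →L[ℝ] ℝ}
    {c m : ℝ} (hf : ∀ x ∈ U, HasFDerivAt f (f' x) x)
    (hv : ∀ x ∈ U, f' x (v x) ≤ -(c * (f x - m))) {J : Set ℝ} (hJ : Convex ℝ J) {ψ : ℝ → E}
    (hψ : ∀ t ∈ J, ψ t ∈ U ∧ HasDerivWithinAt ψ (v (ψ t)) J t) :
    AntitoneOn (fun t ↦ Real.exp (c * t) * (f (ψ t) - m)) J := by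
  have hd : ∀ t ∈ J, HasDerivWithinAt (fun t ↦ Real.exp (c * t) * (f (ψ t) - m))
      (Real.exp (c * t) * (c * 1) * (f (ψ t) - m) +
        Real.exp (c * t) * f' (ψ t) (v (ψ t))) J t := by
    intro t ht
    have h1 : HasDerivWithinAt (fun t ↦ Real.exp (c * t)) (Real.exp (c * t) * (c * 1)) J t :=
      ((hasDerivAt_id t).const_mul c).exp.hasDerivWithinAt
    have h2 : HasDerivWithinAt (fun t ↦ f (ψ t) - m) (f' (ψ t) (v (ψ t))) J t :=
      ((hf _ (hψ t ht).1).comp_hasDerivWithinAt t (hψ t ht).2).sub_const m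
    exact h1.mul h2
  refine antitoneOn_of_hasDerivWithinAt_nonpos hJ (fun t ht ↦ (hd t ht).continuousWithinAt)
    (fun t ht ↦ (hd t (interior_subset ht)).mono interior_subset) fun t ht ↦ ?_
  have h3 := hv _ (hψ t (interior_subset ht)).1
  nlinarith [Real.exp_pos (c * t)]

theorem antitoneOn_along {U : Set E} {v : E → E} {f : E → ℝ} {f' : E → E →L[ℝ] ℝ}
    (hf : ∀ x ∈ U, HasFDerivAt f (f' x) x)
    (hv : ∀ x ∈ U, f' x (v x) ≤ 0) {J : Set ℝ} (hJ : Convex ℝ J) {ψ : ℝ → E}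
    (hψ : ∀ t ∈ J, ψ t ∈ U ∧ HasDerivWithinAt ψ (v (ψ t)) J t) :
    AntitoneOn (fun t ↦ f (ψ t)) J := by
  simpa using antitoneOn_exp_mul_along (c := 0) (m := 0) hf (by simpa using hv) hJ hψ

/-- In finite dimension a `C¹` vector field `F` on an open set `U` agrees, on a compact subset
of `U`, with a bounded Lipschitz field that is a multiple `χ F`, `0 ≤ χ`. -/
theorem exists_cutoff [FiniteDimensional ℝ E] {U S : Set E} (hU : IsOpen U) (hS : IsCompact S)
    (hSU : S ⊆ U) {F : E → E} (hF : ContDiffOn ℝ 1 F U) :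
    ∃ χ : E → ℝ, (∀ x, 0 ≤ χ x) ∧ (∀ x ∈ S, χ x = 1) ∧ ∃ κ L : NNReal,
      LipschitzWith κ (fun x ↦ χ x • F x) ∧ ∀ x, ‖χ x • F x‖ ≤ L := by
  obtain ⟨T, hTc, hST, hTU⟩ := exists_compact_between hS hU hSU
  obtain ⟨χ, h1, h0, hχ⟩ := exists_contMDiffMap_one_nhds_of_subset_interior
    (modelWithCornersSelf ℝ E) (n := 1) hS.isClosed hST
  have hχd : ContDiff ℝ 1 χ := χ.contMDiff.contDiff
  have hsupp : Function.support (fun x ↦ χ x • F x) ⊆ T := fun x hx ↦ by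
    by_contra hxT
    exact hx (by simp [h0 x hxT])
  have hts : tsupport (fun x ↦ χ x • F x) ⊆ T := closure_minimal hsupp hTc.isClosed
  have hcs : HasCompactSupport (fun x ↦ χ x • F x) := hTc.of_isClosed_subset
    (isClosed_tsupport _) hts
  have hd : ContDiff ℝ 1 (fun x ↦ χ x • F x) := by
    refine contDiff_iff_contDiffAt.2 fun x ↦ ?_
    -- `F` is only controlled on `U`; off the support of the product, which lies in `T ⊆ U`, the
    -- product is locally zero.
    by_cases hx : x ∈ tsupport (fun x ↦ χ x • F x)
    · exact hχd.contDiffAt.smul (hF.contDiffAt (hU.mem_nhds (hTU (hts hx))))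
    · exact contDiffAt_const.congr_of_eventuallyEq (notMem_tsupport_iff_eventuallyEq.1 hx)
  obtain ⟨κ, hκ⟩ := hd.lipschitzWith_of_hasCompactSupport hcs one_ne_zero
  obtain ⟨L, hL⟩ := hcs.exists_bound_of_continuous hd.continuous
  exact ⟨χ, fun x ↦ (hχ x).1, fun x hx ↦ h1.self_of_nhdsSet x hx, κ, L.toNNReal, hκ,
    fun x ↦ (hL x).trans (Real.le_coe_toNNReal L)⟩

/-- Global existence, uniqueness and exponential decay for a `C¹` flow along which a function
with compact sublevel sets decays at a uniform rate. -/
theorem exists_trajectory_of_decay [FiniteDimensional ℝ E] {U : Set E} (hU : IsOpen U)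
    {F : E → E} (hF : ContDiffOn ℝ 1 F U) {f : E → ℝ} {f' : E → E →L[ℝ] ℝ} {c m : ℝ}
    (hc : 0 ≤ c) (hf : ∀ x ∈ U, HasFDerivAt f (f' x) x) (hm : ∀ x ∈ U, m ≤ f x)
    (hv : ∀ x ∈ U, f' x (F x) ≤ -(c * (f x - m)))
    (hcpt : ∀ α : ℝ, IsCompact {x | x ∈ U ∧ f x ≤ α}) {x₀ : E} (hx₀ : x₀ ∈ U) :
    ∃ φ : ℝ → E, φ 0 = x₀ ∧
      (∀ t ∈ Ici (0 : ℝ), φ t ∈ U ∧ HasDerivWithinAt φ (F (φ t)) (Ici 0) t) ∧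
      (∀ T : ℝ, 0 < T → ∀ ψ : ℝ → E, ψ 0 = x₀ →
        (∀ t ∈ Ico (0 : ℝ) T, ψ t ∈ U ∧ HasDerivWithinAt ψ (F (ψ t)) (Ico 0 T) t) →
        EqOn ψ φ (Ico 0 T)) ∧
      ∀ t : ℝ, 0 ≤ t → f (φ t) - m ≤ Real.exp (-(c * t)) * (f x₀ - m) := by
  have hv0 : ∀ x ∈ U, f' x (F x) ≤ 0 := fun x hx ↦ (hv x hx).trans
    (neg_nonpos.2 (mul_nonneg hc (sub_nonneg.2 (hm x hx))))
  set S : Set E := {x | x ∈ U ∧ f x ≤ f x₀} with hSdef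
  have hS : IsCompact S := hcpt _
  have : CompleteSpace E := FiniteDimensional.complete ℝ E
  obtain ⟨χ, hχ0, hχ1, κ, L, hLip, hbd⟩ := exists_cutoff hU hS (fun x hx ↦ hx.1) hF
  obtain ⟨φ, hφ0, hφ⟩ := exists_global_integral_curve hLip hbd x₀
  have hφc : Continuous φ := continuous_iff_continuousAt.2 fun t ↦ (hφ t).continuousAt
  have hχv : ∀ x ∈ U, f' x (χ x • F x) ≤ 0 := fun x hx ↦ by
    rw [map_smul, smul_eq_mul]
    exact mul_nonpos_of_nonneg_of_nonpos (hχ0 x) (hv0 x hx)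
  -- Continuous induction: the times spent in `S` form a closed set, and from any of them the curve
  -- stays for a while in the open set `U`, where `f` cannot increase because the cut-off factor is
  -- nonnegative.
  have hφS : ∀ t : ℝ, 0 ≤ t → φ t ∈ S := by
    intro b hb
    have hcl : IsClosed (φ ⁻¹' S ∩ Icc 0 b) := (hS.isClosed.preimage hφc).inter isClosed_Icc
    refine hcl.Icc_subset_of_forall_mem_nhdsWithin (by simp [hSdef, hφ0, hx₀]) ?_ ⟨hb, le_rfl⟩
    rintro t ⟨htS, -⟩
    obtain ⟨ε, hε, hεU⟩ := Metric.mem_nhds_iff.1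
      (hφc.continuousAt.preimage_mem_nhds (hU.mem_nhds htS.1))
    have hanti := antitoneOn_along hf hχv (J := Ico t (t + ε)) (convex_Ico _ _)
      (ψ := φ) fun s hs ↦ ⟨hεU (by
        rw [Metric.mem_ball, Real.dist_eq, abs_lt]; constructor <;> linarith [hs.1, hs.2]),
        (hφ s).hasDerivWithinAt⟩
    filter_upwards [Ioo_mem_nhdsGT (show t < t + ε by linarith)] with s hs
    refine ⟨hεU (by
        rw [Metric.mem_ball, Real.dist_eq, abs_lt]; constructor <;> linarith [hs.1, hs.2]), ?_⟩
    exact (hanti ⟨le_rfl, by linarith⟩ ⟨hs.1.le, hs.2⟩ hs.1.le).trans htS.2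
  have hφF : ∀ t ∈ Ici (0 : ℝ), φ t ∈ U ∧ HasDerivWithinAt φ (F (φ t)) (Ici 0) t := fun t ht ↦
    ⟨(hφS t ht).1, by simpa [hχ1 _ (hφS t ht)] using (hφ t).hasDerivWithinAt (s := Ici 0)⟩
  refine ⟨φ, hφ0, hφF, fun T hT ψ hψ0 hψ t ht ↦ ?_, fun t ht ↦ ?_⟩
  · have hanti := antitoneOn_along hf hv0 (convex_Ico 0 T) hψ
    -- A competing solution is trapped in `S` as well, where the cut-off equals 1, so it solves the
    -- same globally Lipschitz equation as `φ`.
    have hψS : ∀ s ∈ Ico 0 T, ψ s ∈ S := fun s hs ↦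
      ⟨(hψ s hs).1, by simpa [hψ0] using hanti ⟨le_rfl, hT⟩ hs hs.1⟩
    refine ODE_solution_unique (v := fun _ x ↦ χ x • F x) (K := κ) (a := 0) (b := t)
      (fun _ ↦ hLip) (fun s hs ↦ ?_) (fun s hs ↦ ?_) hφc.continuousOn
      (fun s hs ↦ (hφ s).hasDerivWithinAt) (by rw [hψ0, hφ0]) ⟨ht.1, le_rfl⟩
    · exact (hψ s ⟨hs.1, hs.2.trans_lt ht.2⟩).2.continuousWithinAt.mono
        fun r hr ↦ ⟨hr.1, hr.2.trans_lt ht.2⟩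
    · have hs' : s ∈ Ico 0 T := ⟨hs.1, hs.2.trans ht.2⟩
      simp only [hχ1 _ (hψS s hs'), one_smul]
      refine (hψ s hs').2.mono_of_mem_nhdsWithin ?_
      exact mem_of_superset (Ico_mem_nhdsGE hs'.2) (Ico_subset_Ico_left hs'.1)
  · have h := antitoneOn_exp_mul_along hf hv (convex_Ici 0) hφF (mem_Ici.2 le_rfl)
      (mem_Ici.2 ht) ht
    simp only [mul_zero, Real.exp_zero, one_mul, hφ0] at h
    rw [Real.exp_neg, inv_mul_eq_div, le_div_iff₀ (Real.exp_pos _), mul_comm]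
    exact h

end ODE

/-! ### Positive semidefinite families and norm bounds for the Lyapunov operator -/

noncomputable section

/-- A family of square matrices, all positive semidefinite. -/
def PsdFamily {d N : ℕ} (V : Fin N → Matrix (Fin d) (Fin d) ℝ) : Prop := ∀ i, (V i).PosSemidef

namespace PsdFamily

variable {d N : ℕ} {V W : Fin N → Matrix (Fin d) (Fin d) ℝ}

theorem add (hV : PsdFamily V) (hW : PsdFamily W) : PsdFamily (V + W) :=
  fun i ↦ (hV i).add (hW i)

theorem smul (hV : PsdFamily V) {c : ℝ} (hc : 0 ≤ c) : PsdFamily (c • V) :=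
  fun i ↦ (hV i).smul hc

theorem zero : PsdFamily (0 : Fin N → Matrix (Fin d) (Fin d) ℝ) :=
  fun _ ↦ Matrix.PosSemidef.zero

theorem one : PsdFamily (1 : Fin N → Matrix (Fin d) (Fin d) ℝ) :=
  fun _ ↦ Matrix.PosSemidef.one

end PsdFamily

theorem Matrix.IsHermitian.exists_transpose_diagonal {n : ℕ} {A : Matrix (Fin n) (Fin n) ℝ}
    (hA : A.IsHermitian) : ∃ C : Matrix (Fin n) (Fin n) ℝ, Cᵀ * C = 1 ∧
      A = Cᵀ * Matrix.diagonal hA.eigenvalues * C := by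
  refine ⟨(hA.eigenvectorUnitary : Matrix (Fin n) (Fin n) ℝ)ᵀ, ?_, ?_⟩
  · have := Unitary.coe_mul_star_self hA.eigenvectorUnitary
    simpa [Matrix.star_eq_conjTranspose, Matrix.conjTranspose_eq_transpose_of_trivial] using this
  · have := hA.spectral_theorem
    rw [Unitary.conjStarAlgAut_apply] at this
    simpa [Matrix.star_eq_conjTranspose, Matrix.conjTranspose_eq_transpose_of_trivial,
      Function.comp_def] using this

theorem Matrix.PosSemidef.transpose_mul_mul {m n : ℕ} {A : Matrix (Fin m) (Fin m) ℝ}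
    (hA : A.PosSemidef) (B : Matrix (Fin m) (Fin n) ℝ) : (Bᵀ * A * B).PosSemidef := by
  simpa [Matrix.conjTranspose_eq_transpose_of_trivial] using hA.conjTranspose_mul_mul_same B

/-- Diagonalizing `A` turns the trace into a sum of eigenvalues of `A` times diagonal entries of a
congruence of `B`. -/
theorem Matrix.PosSemidef.trace_mul_nonneg {n : ℕ} {A B : Matrix (Fin n) (Fin n) ℝ}
    (hA : A.PosSemidef) (hB : B.PosSemidef) : 0 ≤ (A * B).trace := by
  obtain ⟨C, -, h⟩ := hA.1.exists_transpose_diagonal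
  have hB' := hB.transpose_mul_mul Cᵀ
  rw [Matrix.transpose_transpose] at hB'
  have h2 : (A * B).trace = (Matrix.diagonal hA.1.eigenvalues * (C * B * Cᵀ)).trace := by
    refine (congrArg (fun M ↦ (M * B).trace) h).trans ?_
    simp only [Matrix.mul_assoc]
    rw [Matrix.trace_mul_comm]
    simp only [Matrix.mul_assoc]
  rw [h2, Matrix.trace]
  refine Finset.sum_nonneg fun i _ ↦ ?_
  rw [Matrix.diag_apply, Matrix.diagonal_mul]
  exact mul_nonneg (hA.eigenvalues_nonneg i) hB'.diag_nonneg

/-- Each eigenvalue is at most the sum of all of them. This converts trace bounds into bounds in the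
Loewner order. -/
theorem Matrix.PosSemidef.trace_smul_one_sub {n : ℕ} {A : Matrix (Fin n) (Fin n) ℝ}
    (hA : A.PosSemidef) : (A.trace • (1 : Matrix (Fin n) (Fin n) ℝ) - A).PosSemidef := by
  obtain ⟨C, hC, h⟩ := hA.1.exists_transpose_diagonal
  have ht : A.trace = ∑ i, hA.1.eigenvalues i := by
    simpa using hA.1.trace_eq_sum_eigenvalues
  have h2 : A.trace • (1 : Matrix (Fin n) (Fin n) ℝ) - A =
      Cᵀ * Matrix.diagonal (fun i ↦ A.trace - hA.1.eigenvalues i) * C := by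
    rw [← Matrix.diagonal_sub, Matrix.mul_sub, Matrix.sub_mul, ← h, ← Matrix.smul_one_eq_diagonal]
    simp [hC]
  rw [h2]
  refine (Matrix.PosSemidef.diagonal fun i ↦ ?_).transpose_mul_mul C
  rw [Pi.zero_apply, ht, sub_nonneg]
  exact Finset.single_le_sum (fun j _ ↦ hA.eigenvalues_nonneg j) (Finset.mem_univ i)

theorem Matrix.PosDef.exists_sub_smul_one {n : ℕ} {A : Matrix (Fin n) (Fin n) ℝ}
    (hA : A.PosDef) : ∃ q : ℝ, 0 < q ∧ (A - q • (1 : Matrix (Fin n) (Fin n) ℝ)).PosSemidef := by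
  obtain ⟨C, hC, h⟩ := hA.1.exists_transpose_diagonal
  obtain ⟨q, hq, hqA⟩ : ∃ q : ℝ, 0 < q ∧ ∀ i, q ≤ hA.1.eigenvalues i := by
    rcases isEmpty_or_nonempty (Fin n) with h | h
    · exact ⟨1, one_pos, fun i ↦ (IsEmpty.false i).elim⟩
    · obtain ⟨i, hi⟩ := Finite.exists_min hA.1.eigenvalues
      exact ⟨_, hA.eigenvalues_pos i, hi⟩
  refine ⟨q, hq, ?_⟩
  have h2 : A - q • (1 : Matrix (Fin n) (Fin n) ℝ) =
      Cᵀ * Matrix.diagonal (fun i ↦ hA.1.eigenvalues i - q) * C := by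
    rw [← Matrix.diagonal_sub, Matrix.mul_sub, Matrix.sub_mul, ← h, ← Matrix.smul_one_eq_diagonal]
    simp [hC]
  rw [h2]
  exact (Matrix.PosSemidef.diagonal fun i ↦ sub_nonneg.2 (hqA i)).transpose_mul_mul C

theorem Matrix.posSemidef_transpose_mul_self {m n : ℕ} (B : Matrix (Fin m) (Fin n) ℝ) :
    (Bᵀ * B).PosSemidef := by
  simpa [Matrix.conjTranspose_eq_transpose_of_trivial] using
    Matrix.posSemidef_conjTranspose_mul_self B

/-- Families of square matrices as a normed space (with the supremum norm of all entries). -/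
def familyEquiv (d N : ℕ) :
    (Fin N → Matrix (Fin d) (Fin d) ℝ) ≃ₗ[ℝ] (Fin N → Fin d → Fin d → ℝ) where
  toFun V i a b := V i a b
  invFun V i := Matrix.of (V i)
  map_add' _ _ := rfl
  map_smul' _ _ := rfl
  left_inv _ := rfl
  right_inv _ := rfl

@[simp] theorem familyEquiv_apply {d N : ℕ} (V : Fin N → Matrix (Fin d) (Fin d) ℝ) (i : Fin N)
    (a b : Fin d) : familyEquiv d N V i a b = V i a b := rfl

/-- Writing the exponent as `n q + r` with `r < n` bounds the series by a geometric series times a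
finite sum. -/
theorem summable_norm_pow_of_norm_pow_lt_one {R : Type*} [NormedRing R] {a : R} {n : ℕ}
    (hn : n ≠ 0) (h : ‖a ^ n‖ < 1) : Summable fun t : ℕ ↦ ‖a ^ t‖ := by
  have : NeZero n := ⟨hn⟩
  have hr : Summable fun r : Fin n ↦ ‖a ^ (r : ℕ)‖ := (hasSum_fintype _).summable
  have h1 : Summable fun x : ℕ × Fin n ↦ ‖a ^ n‖ ^ x.1 * ‖a ^ (x.2 : ℕ)‖ :=
    (summable_geometric_of_lt_one (norm_nonneg _) h).mul_of_nonneg hr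
      (fun _ ↦ pow_nonneg (norm_nonneg _) _) (fun _ ↦ norm_nonneg _)
  -- The factor `b` is carried along because `‖1‖ ≤ 1` may fail in a general normed ring, which
  -- matters at `q = 0`.
  have h2 : ∀ (q : ℕ) (b : R), ‖(a ^ n) ^ q * b‖ ≤ ‖a ^ n‖ ^ q * ‖b‖ := by
    intro q b
    induction q with
    | zero => simp
    | succ q ih =>
      rw [pow_succ' (a ^ n), pow_succ' ‖a ^ n‖, mul_assoc, mul_assoc]
      exact (norm_mul_le _ _).trans (mul_le_mul_of_nonneg_left ih (norm_nonneg _))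
  refine (Nat.divModEquiv n).symm.summable_iff.1
    (h1.of_nonneg_of_le (fun _ ↦ norm_nonneg _) fun x ↦ ?_)
  have h3 : a ^ ((Nat.divModEquiv n).symm x) = (a ^ n) ^ x.1 * a ^ (x.2 : ℕ) := by
    rw [← pow_mul, ← pow_add]
    congr 1
    simp [mul_comm]
  simpa only [Function.comp, h3] using h2 x.1 (a ^ (x.2 : ℕ))

/-- Domination of the bilinear forms of `V` by the quadratic forms of `W`. -/
def Dominates {d N : ℕ} (V W : Fin N → Matrix (Fin d) (Fin d) ℝ) : Prop :=
  ∀ i (a b : Fin d → ℝ), |a ⬝ᵥ (V i *ᵥ b)| ≤ a ⬝ᵥ (W i *ᵥ a) + b ⬝ᵥ (W i *ᵥ b)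

/-- Bound |a_x b_y| by a_x² + b_y² and sum over all pairs: each square is counted `d` times. -/
theorem dominates_of_bound {d N : ℕ} {V : Fin N → Matrix (Fin d) (Fin d) ℝ} {c : ℝ}
    (hc : 0 ≤ c) (hV : ∀ i a b, |V i a b| ≤ c) :
    Dominates V ((c * d) • (1 : Fin N → Matrix (Fin d) (Fin d) ℝ)) := by
  intro i a b
  have h1 : |a ⬝ᵥ (V i *ᵥ b)| ≤ ∑ x, ∑ y, c * (a x * a x + b y * b y) := by
    simp only [dotProduct, Matrix.mulVec, Finset.mul_sum]
    refine (Finset.abs_sum_le_sum_abs _ _).trans (Finset.sum_le_sum fun x _ ↦ ?_)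
    refine (Finset.abs_sum_le_sum_abs _ _).trans (Finset.sum_le_sum fun y _ ↦ ?_)
    rw [mul_left_comm, abs_mul]
    refine mul_le_mul (hV i x y) ?_ (abs_nonneg _) hc
    rw [abs_le]; constructor <;> nlinarith [sq_nonneg (a x + b y), sq_nonneg (a x - b y)]
  have h2 : ∀ x : Fin d → ℝ,
      x ⬝ᵥ (((c * d) • (1 : Fin N → Matrix (Fin d) (Fin d) ℝ)) i *ᵥ x) = c * d * (x ⬝ᵥ x) := by
    intro x
    rw [Pi.smul_apply, Pi.one_apply, Matrix.smul_mulVec, Matrix.one_mulVec, dotProduct_smul,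
      smul_eq_mul]
  refine h1.trans_eq ?_
  rw [h2, h2]
  simp only [mul_add, Finset.sum_add_distrib, Finset.sum_const, Finset.card_univ,
    Fintype.card_fin, nsmul_eq_mul, dotProduct]
  simp only [← Finset.mul_sum]
  ring

namespace MJLS

variable {d k N : ℕ} {S : Type*} [MeasurableSpace S] (sys : MJLS d k N S)

/-- `lyapOp` as a linear map. -/
def lyapLin (K : Gain d k N) : Module.End ℝ (Fin N → Matrix (Fin d) (Fin d) ℝ) where
  toFun := sys.lyapOp K
  map_add' V W := by
    ext1 i
    simp [lyapOp, expOp, Finset.sum_add_distrib, mul_add, add_mul]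
  map_smul' c V := by
    ext1 i
    simp [lyapOp, expOp, smul_comm _ c, ← Finset.smul_sum]

@[simp] theorem lyapLin_apply (K : Gain d k N) (V : Fin N → Matrix (Fin d) (Fin d) ℝ) :
    sys.lyapLin K V = sys.lyapOp K V := rfl

theorem lyapLin_pow_apply (K : Gain d k N) (t : ℕ) (V : Fin N → Matrix (Fin d) (Fin d) ℝ) :
    (sys.lyapLin K ^ t) V = (sys.lyapOp K)^[t] V := Module.End.pow_apply _ _ _

/-- `lyapOp` as a bounded operator. -/
def lyapCLM (K : Gain d k N) : (Fin N → Fin d → Fin d → ℝ) →L[ℝ] (Fin N → Fin d → Fin d → ℝ) :=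
  LinearMap.toContinuousLinearMap
    ((familyEquiv d N).toLinearMap ∘ₗ sys.lyapLin K ∘ₗ (familyEquiv d N).symm.toLinearMap)

@[simp] theorem lyapCLM_apply (K : Gain d k N) (V : Fin N → Fin d → Fin d → ℝ) :
    sys.lyapCLM K V = familyEquiv d N (sys.lyapOp K ((familyEquiv d N).symm V)) := rfl

theorem lyapCLM_pow_apply (K : Gain d k N) (t : ℕ) (V : Fin N → Matrix (Fin d) (Fin d) ℝ) :
    (sys.lyapCLM K ^ t) (familyEquiv d N V) = familyEquiv d N ((sys.lyapLin K ^ t) V) := by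
  induction t with
  | zero => rfl
  | succ t ih => rw [pow_succ', pow_succ', mul_apply_eq_comp, ih]; rfl

theorem contDiff_closedLoop_apply (i : Fin N) (a b : Fin d) {n : WithTop ℕ∞} :
    ContDiff ℝ n fun K : Gain d k N ↦ sys.closedLoop K i a b := by
  simp only [closedLoop, Matrix.sub_apply, Matrix.mul_apply, Gain.mat, Matrix.of_apply]
  fun_prop

theorem contDiff_lyapCLM {n : WithTop ℕ∞} : ContDiff ℝ n (sys.lyapCLM) := by
  rw [contDiff_clm_apply_iff]
  intro V
  refine contDiff_pi.2 fun i ↦ contDiff_pi.2 fun a ↦ contDiff_pi.2 fun b ↦ ?_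
  simp only [lyapCLM_apply, familyEquiv_apply, lyapOp, Matrix.mul_apply, Matrix.transpose_apply]
  have := fun a b ↦ sys.contDiff_closedLoop_apply i a b (n := n)
  fun_prop

theorem expOp_posSemidef (hp : ∀ i j, 0 ≤ sys.p i j) {V : Fin N → Matrix (Fin d) (Fin d) ℝ}
    (hV : PsdFamily V) (i : Fin N) : (sys.expOp V i).PosSemidef :=
  Matrix.posSemidef_sum _ fun j _ ↦ (hV j).smul (hp i j)

theorem lyapOp_psd (hp : ∀ i j, 0 ≤ sys.p i j) (K : Gain d k N)
    {V : Fin N → Matrix (Fin d) (Fin d) ℝ} (hV : PsdFamily V) : PsdFamily (sys.lyapOp K V) :=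
  fun i ↦ (sys.expOp_posSemidef hp hV i).transpose_mul_mul _

theorem lyapLin_pow_psd (hp : ∀ i j, 0 ≤ sys.p i j) (K : Gain d k N) (t : ℕ)
    {V : Fin N → Matrix (Fin d) (Fin d) ℝ} (hV : PsdFamily V) :
    PsdFamily ((sys.lyapLin K ^ t) V) := by
  induction t with
  | zero => exact hV
  | succ t ih => rw [pow_succ']; exact sys.lyapOp_psd hp K ih

theorem dotProduct_lyapOp_mulVec (K : Gain d k N) (V : Fin N → Matrix (Fin d) (Fin d) ℝ)
    (i : Fin N) (a b : Fin d → ℝ) : a ⬝ᵥ (sys.lyapOp K V i *ᵥ b) =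
      ∑ j, sys.p i j * ((sys.closedLoop K i *ᵥ a) ⬝ᵥ (V j *ᵥ (sys.closedLoop K i *ᵥ b))) := by
  rw [lyapOp, ← Matrix.mulVec_mulVec, ← Matrix.mulVec_mulVec, Matrix.dotProduct_mulVec,
    Matrix.vecMul_transpose, expOp, Matrix.sum_mulVec, dotProduct_sum]
  simp [Matrix.smul_mulVec]

theorem _root_.Dominates.lyapOp (hp : ∀ i j, 0 ≤ sys.p i j) (K : Gain d k N)
    {V W : Fin N → Matrix (Fin d) (Fin d) ℝ} (h : Dominates V W) :
    Dominates (sys.lyapOp K V) (sys.lyapOp K W) := by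
  intro i a b
  simp only [dotProduct_lyapOp_mulVec, ← Finset.sum_add_distrib, ← mul_add]
  refine (Finset.abs_sum_le_sum_abs _ _).trans (Finset.sum_le_sum fun j _ ↦ ?_)
  rw [abs_mul, abs_of_nonneg (hp i j)]
  exact mul_le_mul_of_nonneg_left (h j _ _) (hp i j)

theorem _root_.Dominates.lyapLin_pow (hp : ∀ i j, 0 ≤ sys.p i j) (K : Gain d k N) (t : ℕ)
    {V W : Fin N → Matrix (Fin d) (Fin d) ℝ} (h : Dominates V W) :
    Dominates ((sys.lyapLin K ^ t) V) ((sys.lyapLin K ^ t) W) := by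
  induction t with
  | zero => exact h
  | succ t ih => rw [pow_succ']; exact ih.lyapOp sys hp K

/-- Positivity makes the family 1 control everything: a family with entries at most `v` is dominated
by a multiple of 1, powers of ℒ preserve domination, and testing on two basis vectors bounds each
entry of ℒᵗ(V) by two diagonal entries of ℒᵗ(1). -/
theorem norm_lyapCLM_pow_le (hp : ∀ i j, 0 ≤ sys.p i j) (K : Gain d k N) (t : ℕ) {η : ℝ}
    (hη : 0 ≤ η)
    (h : ∀ i a, (sys.lyapLin K ^ t) (1 : Fin N → Matrix (Fin d) (Fin d) ℝ) i a a ≤ η) :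
    ‖sys.lyapCLM K ^ t‖ ≤ d * (2 * η) := by
  refine ContinuousLinearMap.opNorm_le_bound _ (by positivity) fun V ↦ ?_
  obtain ⟨V, rfl⟩ := (familyEquiv d N).surjective V
  set v := ‖familyEquiv d N V‖ with hv
  have hb : ∀ i a b, |V i a b| ≤ v := fun i a b ↦
    (norm_le_pi_norm (familyEquiv d N V i a) b).trans
      ((norm_le_pi_norm (familyEquiv d N V i) a).trans (norm_le_pi_norm _ i))
  have hv0 : 0 ≤ v := norm_nonneg _
  have hr : 0 ≤ d * (2 * η) * v := by positivity
  rw [lyapCLM_pow_apply]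
  refine (pi_norm_le_iff_of_nonneg hr).2 fun i ↦ (pi_norm_le_iff_of_nonneg hr).2 fun a ↦
    (pi_norm_le_iff_of_nonneg hr).2 fun b ↦ ?_
  have h1 := (dominates_of_bound hv0 hb).lyapLin_pow sys hp K t i (Pi.single a 1) (Pi.single b 1)
  simp only [Matrix.mulVec_single_one, single_one_dotProduct, map_smul, Pi.smul_apply,
    Matrix.smul_apply, smul_eq_mul, Matrix.col_apply] at h1
  rw [familyEquiv_apply, Real.norm_eq_abs]
  refine h1.trans ?_
  have hc : 0 ≤ v * d := by positivity
  nlinarith [mul_le_mul_of_nonneg_left (h i a) hc, mul_le_mul_of_nonneg_left (h i b) hc]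

end MJLS

end

/-! ### Propagation of second moments along the Markov chain -/

noncomputable section

theorem setIntegral_eq_sum_fiber {S ι : Type*} [MeasurableSpace S] [Fintype ι]
    [MeasurableSpace ι] [MeasurableSingletonClass ι] {μ : Measure S} {X : S → ι}
    (hX : Measurable X) {f : S → ℝ} {B : Set S} (hB : MeasurableSet B) (hf : Integrable f μ) :
    ∫ s in B, f s ∂μ = ∑ i, ∫ s in B ∩ X ⁻¹' {i}, f s ∂μ := by
  rw [← integral_iUnion_fintype (fun i ↦ hB.inter (hX (measurableSet_singleton i)))
    (fun i j hij ↦ ?_) (fun i ↦ hf.integrableOn)]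
  · rw [← inter_iUnion, ← preimage_iUnion, iUnion_singleton_eq_range, range_id', preimage_univ,
      inter_univ]
  · refine disjoint_left.2 fun s hi hj ↦ hij ?_
    exact (mem_singleton_iff.1 hi.2).symm.trans (mem_singleton_iff.1 hj.2)

theorem integral_eq_sum_fiber {S ι : Type*} [MeasurableSpace S] [Fintype ι]
    [MeasurableSpace ι] [MeasurableSingletonClass ι] {μ : Measure S} {X : S → ι}
    (hX : Measurable X) {f : S → ℝ} (hf : Integrable f μ) :
    ∫ s, f s ∂μ = ∑ i, ∫ s in X ⁻¹' {i}, f s ∂μ := by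
  simpa using setIntegral_eq_sum_fiber hX MeasurableSet.univ hf

theorem ProbabilityTheory.IndepFun.setIntegral_comp_eq {S α β : Type*} [MeasurableSpace S]
    [MeasurableSpace α] [MeasurableSpace β] {μ : Measure S} [IsProbabilityMeasure μ] {X : S → α}
    {Y : S → β} (h : IndepFun X Y μ) (hX : Measurable X) (hY : Measurable Y) {g : α → ℝ}
    (hg : Measurable g) {C : Set β} (hC : MeasurableSet C) :
    ∫ s in Y ⁻¹' C, g (X s) ∂μ = μ.real (Y ⁻¹' C) * ∫ s, g (X s) ∂μ := by
  have h1 : IndepFun (g ∘ X) ((C.indicator fun _ ↦ (1 : ℝ)) ∘ Y) μ :=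
    h.comp hg (measurable_const.indicator hC)
  have h2 := h1.integral_fun_mul_eq_mul_integral (hg.comp hX).aestronglyMeasurable
    ((measurable_const.indicator hC).comp hY).aestronglyMeasurable
  have h3 : ∀ s, (g ∘ X) s * ((C.indicator fun _ ↦ (1 : ℝ)) ∘ Y) s =
      (Y ⁻¹' C).indicator (fun s ↦ g (X s)) s := by
    intro s
    by_cases hs : Y s ∈ C <;> simp [hs]
  have h4 : ((C.indicator fun _ ↦ (1 : ℝ)) ∘ Y) = (Y ⁻¹' C).indicator fun _ ↦ (1 : ℝ) := rfl
  simp only [h3] at h2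
  rw [integral_indicator (hY hC), h4, integral_indicator (hY hC)] at h2
  simpa [mul_comm, measureReal_def] using h2

namespace MJLS

variable {d k N : ℕ} {S : Type*} [MeasurableSpace S]

/-- The standing assumptions on the random elements of the problem. -/
structure Admissible (sys : MJLS d k N S) : Prop where
  prob : IsProbabilityMeasure sys.Pr
  chain : IsMarkovChain sys.Pr sys.ω sys.p sys.π₀
  meas : Measurable sys.x₀
  sq : ∀ a, MemLp (fun s => sys.x₀ s a) 2 sys.Pr
  indep : IndepFun sys.x₀ (fun s t => sys.ω t s) sys.Pr

variable (sys : MJLS d k N S)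

theorem state_congr (K : Gain d k N) {w w' : ℕ → Fin N} (v : Fin d → ℝ) {t : ℕ}
    (h : ∀ l < t, w l = w' l) : sys.state K w v t = sys.state K w' v t := by
  induction t with
  | zero => rfl
  | succ t ih => rw [state, state, ih fun l hl ↦ h l (hl.trans t.lt_succ_self), h t t.lt_succ_self]

theorem measurable_state (K : Gain d k N) (w : ℕ → Fin N) (t : ℕ) :
    Measurable fun v ↦ sys.state K w v t := by
  induction t with
  | zero => exact measurable_id
  | succ t ih =>
    refine measurable_pi_lambda _ fun a ↦ ?_
    simp only [state, Matrix.mulVec, dotProduct]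
    exact Finset.measurable_sum _ fun b _ ↦ ((measurable_pi_apply b).comp ih).const_mul _

variable {sys}

namespace Admissible

variable (h : sys.Admissible)
include h

theorem measurable_x (K : Gain d k N) (t : ℕ) : Measurable (sys.x K t) := by
  induction t with
  | zero => exact h.meas
  | succ t ih =>
    refine measurable_pi_lambda _ fun a ↦ ?_
    simp only [x, state, Matrix.mulVec, dotProduct]
    refine Finset.measurable_sum _ fun b _ ↦ Measurable.mul ?_ ((measurable_pi_apply b).comp ih)
    exact (measurable_of_countable fun i ↦ sys.closedLoop K i a b).comp (h.chain.measurable t)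

theorem memLp_x (K : Gain d k N) (t : ℕ) (a : Fin d) : MemLp (fun s ↦ sys.x K t s a) 2 sys.Pr := by
  induction t generalizing a with
  | zero => exact h.sq a
  | succ t ih =>
    simp only [x, state, Matrix.mulVec, dotProduct]
    refine memLp_finsetSum _ fun b _ ↦ ?_
    refine (ih b).of_le_mul (c := ∑ i, |sys.closedLoop K i a b|) ?_ (ae_of_all _ fun s ↦ ?_)
    · exact (((measurable_of_countable fun i ↦ sys.closedLoop K i a b).comp
        (h.chain.measurable t)).mul
        ((measurable_pi_apply b).comp (h.measurable_x K t))).aestronglyMeasurable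
    · rw [norm_mul]
      refine mul_le_mul_of_nonneg_right ?_ (norm_nonneg _)
      exact Finset.single_le_sum (f := fun i ↦ |sys.closedLoop K i a b|)
        (fun i _ ↦ abs_nonneg _) (Finset.mem_univ (sys.ω t s))

theorem integrable_quad (K : Gain d k N) (t : ℕ) (M : Matrix (Fin d) (Fin d) ℝ) :
    Integrable (fun s ↦ sys.x K t s ⬝ᵥ (M *ᵥ sys.x K t s)) sys.Pr := by
  simp only [Matrix.mulVec, dotProduct, Finset.mul_sum]
  refine integrable_finsetSum _ fun a _ ↦ integrable_finsetSum _ fun b _ ↦ ?_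
  have := ((h.memLp_x K t a).integrable_mul (h.memLp_x K t b)).const_mul (M a b)
  refine this.congr (ae_of_all _ fun s ↦ ?_)
  simp only [Pi.mul_apply]; ring

theorem integrable_quad_mode (K : Gain d k N) (t r : ℕ) (V : Fin N → Matrix (Fin d) (Fin d) ℝ) :
    Integrable (fun s ↦ sys.x K t s ⬝ᵥ (V (sys.ω r s) *ᵥ sys.x K t s)) sys.Pr := by
  have h1 : ∀ i, MeasurableSet (sys.ω r ⁻¹' {i}) :=
    fun i ↦ h.chain.measurable r (measurableSet_singleton i)
  have h2 := integrable_finsetSum Finset.univ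
    fun (i : Fin N) _ ↦ (h.integrable_quad K t (V i)).indicator (h1 i)
  refine h2.congr (ae_of_all _ fun s ↦ ?_)
  simp only [Set.indicator, mem_preimage, mem_singleton_iff]
  simp

/-- The Markov step: given the mode at time `t`, the mode at time `t + 1` is independent of the
state at time `t`. -/
theorem setIntegral_step (K : Gain d k N) (t : ℕ) (M : Matrix (Fin d) (Fin d) ℝ) (i j : Fin N) :
    ∫ s in sys.ω t ⁻¹' {i} ∩ sys.ω (t + 1) ⁻¹' {j}, sys.x K t s ⬝ᵥ (M *ᵥ sys.x K t s) ∂sys.Pr =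
      sys.p i j * ∫ s in sys.ω t ⁻¹' {i}, sys.x K t s ⬝ᵥ (M *ᵥ sys.x K t s) ∂sys.Pr := by
  have := h.prob
  have hω : ∀ r i, MeasurableSet (sys.ω r ⁻¹' {i}) :=
    fun r i ↦ h.chain.measurable r (measurableSet_singleton i)
  have hpath : Measurable fun s (l : Fin (t + 1)) ↦ sys.ω l s :=
    measurable_pi_lambda _ fun l ↦ h.chain.measurable l
  have hall : Measurable fun s (l : ℕ) ↦ sys.ω l s :=
    measurable_pi_lambda _ fun l ↦ h.chain.measurable l
  -- Both sides are split over the whole mode path up to time `t`; paths not ending in `i`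
  -- contribute nothing.
  rw [setIntegral_eq_sum_fiber hpath ((hω _ _).inter (hω _ _)) (h.integrable_quad K t M),
    setIntegral_eq_sum_fiber hpath (hω _ _) (h.integrable_quad K t M), Finset.mul_sum]
  refine Finset.sum_congr rfl fun f _ ↦ ?_
  by_cases hf : f (Fin.last t) = i
  swap
  · have h1 : sys.ω t ⁻¹' {i} ∩ (fun s (l : Fin (t + 1)) ↦ sys.ω l s) ⁻¹' {f} = ∅ := by
      refine eq_empty_of_forall_notMem fun s hs ↦ hf ?_
      rw [← mem_singleton_iff.1 hs.2]
      exact hs.1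
    rw [inter_right_comm, h1]
    simp
  -- The path `f` is continued by `j`, so that `w (t + 1) = j`; the values after `t + 1` play no
  -- role.
  set w : ℕ → Fin N := fun l ↦ if hl : l < t + 1 then f ⟨l, hl⟩ else j with hw
  have hw1 : w (t + 1) = j := by simp [hw]
  have hw0 : w t = i := by simp [hw, ← hf, Fin.last]
  have hwl : ∀ l (hl : l < t + 1), w l = f ⟨l, hl⟩ := fun l hl ↦ dif_pos hl
  have hA : sys.ω t ⁻¹' {i} ∩ (fun s (l : Fin (t + 1)) ↦ sys.ω l s) ⁻¹' {f} =
      {s | ∀ l ≤ t, sys.ω l s = w l} := by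
    ext s
    simp only [mem_inter_iff, mem_preimage, mem_singleton_iff, mem_ofPred_eq, funext_iff]
    refine ⟨fun hs l hl ↦ ?_, fun hs ↦ ⟨hw0 ▸ hs t le_rfl, fun l ↦ ?_⟩⟩
    · rw [hwl l (Nat.lt_succ_of_le hl)]; exact hs.2 ⟨l, Nat.lt_succ_of_le hl⟩
    · rw [hs l (Nat.le_of_lt_succ l.2), hwl l l.2]
  have hB : sys.ω t ⁻¹' {i} ∩ sys.ω (t + 1) ⁻¹' {j} ∩
      (fun s (l : Fin (t + 1)) ↦ sys.ω l s) ⁻¹' {f} = {s | ∀ l ≤ t + 1, sys.ω l s = w l} := by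
    rw [inter_right_comm, hA]
    ext s
    simp only [mem_inter_iff, mem_preimage, mem_singleton_iff, mem_ofPred_eq]
    refine ⟨fun hs l hl ↦ ?_, fun hs ↦ ⟨fun l hl ↦ hs l (hl.trans t.le_succ), ?_⟩⟩
    · rcases Nat.le_succ_iff.1 hl with hl | rfl
      · exact hs.1 l hl
      · rw [hw1]; exact hs.2
    · rw [← hw1]; exact hs _ le_rfl
  have hC : ∀ r, MeasurableSet {u : ℕ → Fin N | ∀ l ≤ r, u l = w l} := fun r ↦ by
    have : {u : ℕ → Fin N | ∀ l ≤ r, u l = w l} = ⋂ l ∈ Iic r, (fun u ↦ u l) ⁻¹' {w l} := by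
      ext u; simp
    rw [this]
    exact MeasurableSet.biInter (to_countable _)
      fun l _ ↦ measurable_pi_apply l (measurableSet_singleton _)
  have hquad : Measurable fun v ↦ sys.state K w v t ⬝ᵥ (M *ᵥ sys.state K w v t) := by
    have hs := fun a ↦ (measurable_pi_apply a).comp (sys.measurable_state K w t)
    simp only [Matrix.mulVec, dotProduct]
    exact Finset.measurable_sum _ fun a _ ↦ (hs a).mul
      (Finset.measurable_sum _ fun b _ ↦ (hs b).const_mul _)
  -- On a path cylinder the state is a fixed function of x₀, so independence factors the integral
  -- into the probability of the cylinder and an expectation that does not depend on `r`. The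
  -- cylinders for `t` and `t + 1` then differ only by the transition probability.
  have hint : ∀ r, t ≤ r →
      ∫ s in {s | ∀ l ≤ r, sys.ω l s = w l}, sys.x K t s ⬝ᵥ (M *ᵥ sys.x K t s) ∂sys.Pr =
        sys.Pr.real {s | ∀ l ≤ r, sys.ω l s = w l} *
          ∫ s, sys.state K w (sys.x₀ s) t ⬝ᵥ (M *ᵥ sys.state K w (sys.x₀ s) t) ∂sys.Pr := by
    intro r hr
    have hpre : {s | ∀ l ≤ r, sys.ω l s = w l} =
      (fun s l ↦ sys.ω l s) ⁻¹' {u : ℕ → Fin N | ∀ l ≤ r, u l = w l} := rfl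
    rw [hpre, ← h.indep.setIntegral_comp_eq h.meas hall hquad (hC r)]
    refine setIntegral_congr_fun (hall (hC r)) fun s hs ↦ ?_
    have : sys.x K t s = sys.state K w (sys.x₀ s) t :=
      sys.state_congr K _ fun l hl ↦ hs l (hl.le.trans hr)
    simp only [this]
  rw [hA, hB, hint _ le_rfl, hint _ t.le_succ, h.chain.step, hw0, hw1]
  ring

/-- Second moments propagate backwards by `lyapOp`. -/
theorem integral_quad_succ (K : Gain d k N) (t : ℕ) (V : Fin N → Matrix (Fin d) (Fin d) ℝ) :
    ∫ s, sys.x K (t + 1) s ⬝ᵥ (V (sys.ω (t + 1) s) *ᵥ sys.x K (t + 1) s) ∂sys.Pr =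
      ∫ s, sys.x K t s ⬝ᵥ (sys.lyapOp K V (sys.ω t s) *ᵥ sys.x K t s) ∂sys.Pr := by
  have hω : ∀ r i, MeasurableSet (sys.ω r ⁻¹' {i}) :=
    fun r i ↦ h.chain.measurable r (measurableSet_singleton i)
  rw [integral_eq_sum_fiber (h.chain.measurable t) (h.integrable_quad_mode K (t + 1) (t + 1) V),
    integral_eq_sum_fiber (h.chain.measurable t) (h.integrable_quad_mode K t t _)]
  refine Finset.sum_congr rfl fun i _ ↦ ?_
  rw [setIntegral_eq_sum_fiber (h.chain.measurable (t + 1)) (hω t i)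
    (h.integrable_quad_mode K (t + 1) (t + 1) V)]
  have h1 : ∀ j, ∫ s in sys.ω t ⁻¹' {i} ∩ sys.ω (t + 1) ⁻¹' {j},
      sys.x K (t + 1) s ⬝ᵥ (V (sys.ω (t + 1) s) *ᵥ sys.x K (t + 1) s) ∂sys.Pr =
      ∫ s in sys.ω t ⁻¹' {i}, sys.p i j * (sys.x K t s ⬝ᵥ
        (((sys.closedLoop K i)ᵀ * V j * sys.closedLoop K i) *ᵥ sys.x K t s)) ∂sys.Pr := by
    intro j
    rw [integral_const_mul, ← h.setIntegral_step]
    refine setIntegral_congr_fun ((hω t i).inter (hω _ j)) fun s hs ↦ ?_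
    have hx : sys.x K (t + 1) s = sys.closedLoop K i *ᵥ sys.x K t s := by
      rw [← mem_singleton_iff.1 hs.1]; rfl
    simp only [mem_singleton_iff.1 hs.2, hx]
    rw [← Matrix.mulVec_mulVec, ← Matrix.mulVec_mulVec, Matrix.dotProduct_mulVec _ (_)ᵀ,
      Matrix.vecMul_transpose]
  rw [Finset.sum_congr rfl fun j _ ↦ h1 j, ← integral_finsetSum _ fun j _ ↦
    ((h.integrable_quad K t _).const_mul _).integrableOn]
  refine setIntegral_congr_fun (hω t i) fun s hs ↦ ?_
  simp only [mem_singleton_iff.1 hs, dotProduct_lyapOp_mulVec]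
  refine Finset.sum_congr rfl fun j _ ↦ ?_
  rw [← Matrix.mulVec_mulVec, ← Matrix.mulVec_mulVec, Matrix.dotProduct_mulVec _ (_)ᵀ,
    Matrix.vecMul_transpose]

end Admissible

variable (sys)

/-- The initial correlation matrices `E[x₀ x₀ᵀ 1{ω(0) = i}]`. -/
def initCorr (i : Fin N) : Matrix (Fin d) (Fin d) ℝ := sys.π₀ i • secondMoment sys.Pr sys.x₀

/-- The pairing `∑ᵢ tr (𝐗ᵢ(0) Vᵢ)` with the initial correlation matrices. -/
def initPairing : (Fin N → Matrix (Fin d) (Fin d) ℝ) →ₗ[ℝ] ℝ where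
  toFun V := ∑ i, (sys.initCorr i * V i).trace
  map_add' V W := by simp [mul_add, Finset.sum_add_distrib]
  map_smul' c V := by simp [Finset.mul_sum]

theorem initPairing_apply (V : Fin N → Matrix (Fin d) (Fin d) ℝ) :
    sys.initPairing V = ∑ i, (sys.initCorr i * V i).trace := rfl

variable {sys}

/-- Iterating the backward step moves all dynamics into the power of ℒ; at time 0, independence of
x₀ and ω(0) leaves the initial correlations. -/
theorem Admissible.integral_quad (h : sys.Admissible) (K : Gain d k N) (t : ℕ)
    (V : Fin N → Matrix (Fin d) (Fin d) ℝ) :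
    ∫ s, sys.x K t s ⬝ᵥ (V (sys.ω t s) *ᵥ sys.x K t s) ∂sys.Pr =
      sys.initPairing ((sys.lyapLin K ^ t) V) := by
  induction t generalizing V with
  | zero =>
    have := h.prob
    have hall : Measurable fun s (l : ℕ) ↦ sys.ω l s :=
      measurable_pi_lambda _ fun l ↦ h.chain.measurable l
    rw [integral_eq_sum_fiber (h.chain.measurable 0) (h.integrable_quad_mode K 0 0 V)]
    change _ = ∑ i, (sys.initCorr i * V i).trace
    refine Finset.sum_congr rfl fun i _ ↦ ?_
    have hq : Measurable fun v : Fin d → ℝ ↦ v ⬝ᵥ (V i *ᵥ v) := by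
      simp only [Matrix.mulVec, dotProduct]
      fun_prop
    have h1 := h.indep.setIntegral_comp_eq h.meas hall hq
      (measurable_pi_apply 0 (measurableSet_singleton i))
    have h2 : (fun s (l : ℕ) ↦ sys.ω l s) ⁻¹' ((fun w : ℕ → Fin N ↦ w 0) ⁻¹' {i}) =
      sys.ω 0 ⁻¹' {i} := rfl
    have h3 : sys.Pr.real (sys.ω 0 ⁻¹' {i}) = sys.π₀ i := h.chain.init i
    rw [h2, h3] at h1
    refine (setIntegral_congr_fun (h.chain.measurable 0 (measurableSet_singleton i))
      fun s hs ↦ ?_).trans (h1.trans ?_)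
    · simp only [mem_singleton_iff.1 hs]; rfl
    · rw [initCorr, Matrix.smul_mul, Matrix.trace_smul, smul_eq_mul]
      congr 1
      have h4 : ∀ a b, Integrable (fun s ↦ sys.x₀ s a * (V i a b * sys.x₀ s b)) sys.Pr := by
        intro a b
        refine (((h.sq a).integrable_mul (h.sq b)).const_mul (V i a b)).congr
          (ae_of_all _ fun s ↦ ?_)
        simp only [Pi.mul_apply]; ring
      simp only [Matrix.mulVec, dotProduct, Finset.mul_sum, Matrix.trace, Matrix.diag_apply,
        Matrix.mul_apply]
      rw [integral_finsetSum _ fun a _ ↦ integrable_finsetSum _ fun b _ ↦ h4 a b]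
      simp only [integral_finsetSum _ fun b _ ↦ h4 _ b]
      rw [Finset.sum_comm]
      refine Finset.sum_congr rfl fun b _ ↦ Finset.sum_congr rfl fun a _ ↦ ?_
      rw [secondMoment, Matrix.of_apply, ← integral_mul_const]
      exact integral_congr_ae (ae_of_all _ fun s ↦ by ring)
  | succ t ih =>
    rw [h.integral_quad_succ, ih, pow_succ]; rfl

theorem dotProduct_single_mulVec {n : ℕ} (v : Fin n → ℝ) (a b : Fin n) :
    v ⬝ᵥ (Matrix.single a b (1 : ℝ) *ᵥ v) = v a * v b := by
  simp [Matrix.single_mulVec, dotProduct, Function.update_apply]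

theorem Admissible.secondMoment_restrict (h : sys.Admissible) (K : Gain d k N) (t : ℕ)
    (i : Fin N) (a b : Fin d) :
    secondMoment (sys.Pr.restrict {s | sys.ω t s = i}) (sys.x K t) a b =
      sys.initPairing ((sys.lyapLin K ^ t) (Pi.single i (Matrix.single a b 1))) := by
  have hm : MeasurableSet {s | sys.ω t s = i} := h.chain.measurable t (measurableSet_singleton i)
  rw [← h.integral_quad, secondMoment, Matrix.of_apply, ← integral_indicator hm]
  refine integral_congr_ae (ae_of_all _ fun s ↦ ?_)
  by_cases hs : sys.ω t s = i
  · simp [hs, Set.indicator, dotProduct_single_mulVec]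
  · simp [hs, Set.indicator]

theorem Admissible.secondMoment_eq (h : sys.Admissible) (K : Gain d k N) (t : ℕ)
    (a b : Fin d) :
    secondMoment sys.Pr (sys.x K t) a b =
      sys.initPairing ((sys.lyapLin K ^ t) fun _ ↦ Matrix.single a b 1) := by
  rw [← h.integral_quad, secondMoment, Matrix.of_apply]
  exact integral_congr_ae (ae_of_all _ fun s ↦ (dotProduct_single_mulVec _ a b).symm)

variable (sys) in
/-- The problem conditioned on the initial mode `i` and started at `v`. -/
def condSys (i : Fin N) (v : Fin d → ℝ) : MJLS d k N S :=
  { sys with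
    Pr := ProbabilityTheory.cond sys.Pr {s | sys.ω 0 s = i}
    x₀ := fun _ ↦ v
    π₀ := Pi.single i 1 }

theorem state_condSys (i : Fin N) (v : Fin d → ℝ) (K : Gain d k N) (w : ℕ → Fin N)
    (u : Fin d → ℝ) (t : ℕ) : (sys.condSys i v).state K w u t = sys.state K w u t := by
  induction t with
  | zero => rfl
  | succ t ih => rw [state, ih]; rfl

/-- Stability is defined by conditioning on the initial mode and starting at a fixed vector. Since
this is again an admissible problem, the moment formula applies to it. -/
theorem Admissible.condSys (h : sys.Admissible) {i : Fin N} (hi : 0 < sys.π₀ i)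
    (v : Fin d → ℝ) : (sys.condSys i v).Admissible := by
  have := h.prob
  have hm : ∀ r j, MeasurableSet {s | sys.ω r s = j} :=
    fun r j ↦ h.chain.measurable r (measurableSet_singleton j)
  have hreal : sys.Pr.real {s | sys.ω 0 s = i} = sys.π₀ i := h.chain.init i
  have hne : sys.Pr {s | sys.ω 0 s = i} ≠ 0 := fun h0 ↦ by
    rw [measureReal_def, h0] at hreal
    exact hi.ne hreal
  have hp : IsProbabilityMeasure (sys.condSys i v).Pr := cond_isProbabilityMeasure hne
  have hcond : ∀ B : Set S, (ProbabilityTheory.cond sys.Pr {s | sys.ω 0 s = i}).real B =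
      (sys.π₀ i)⁻¹ * sys.Pr.real ({s | sys.ω 0 s = i} ∩ B) := fun B ↦ by
    rw [measureReal_def, cond_apply (hm 0 i), ENNReal.toReal_mul, ENNReal.toReal_inv, ← hreal]
    rfl
  refine ⟨hp, ⟨h.chain.measurable, h.chain.p_nonneg, h.chain.p_sum, fun j ↦ ?_, fun t w ↦ ?_⟩,
    measurable_const, fun a ↦ memLp_const _, indepFun_const_left _ _⟩
  · refine (hcond _).trans ?_
    rcases eq_or_ne j i with rfl | hj
    · have hs : {s | sys.ω 0 s = j} ∩ {s | (sys.condSys j v).ω 0 s = j} = {s | sys.ω 0 s = j} :=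
        inter_self _
      rw [hs, hreal, inv_mul_cancel₀ hi.ne']
      simp [MJLS.condSys]
    · have : {s | sys.ω 0 s = i} ∩ {s | sys.ω 0 s = j} = ∅ :=
        eq_empty_of_forall_notMem fun s hs ↦ hj (hs.2.symm.trans hs.1)
      have h0 : {s | sys.ω 0 s = i} ∩ {s | (sys.condSys i v).ω 0 s = j} = ∅ := this
      rw [h0]
      simp [MJLS.condSys, hj]
  · refine (hcond _).trans ?_
    have h1 := hcond {s | ∀ l ≤ t, sys.ω l s = w l}
    have h2 : ∀ r, w 0 = i → {s | sys.ω 0 s = i} ∩ {s | ∀ l ≤ r, sys.ω l s = w l} =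
        {s | ∀ l ≤ r, sys.ω l s = w l} := fun r hw ↦
      inter_eq_right.2 fun s hs ↦ hw ▸ hs 0 r.zero_le
    have h3 : ∀ r, w 0 ≠ i → {s | sys.ω 0 s = i} ∩ {s | ∀ l ≤ r, sys.ω l s = w l} = ∅ :=
      fun r hw ↦ eq_empty_of_forall_notMem fun s hs ↦ hw ((hs.2 0 r.zero_le).symm.trans hs.1)
    change (sys.π₀ i)⁻¹ * sys.Pr.real ({s | sys.ω 0 s = i} ∩ {s | ∀ l ≤ t + 1, sys.ω l s = w l}) =
      (ProbabilityTheory.cond sys.Pr {s | sys.ω 0 s = i}).real {s | ∀ l ≤ t, sys.ω l s = w l} *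
        sys.p (w t) (w (t + 1))
    rw [h1]
    -- A path cylinder is either contained in the conditioning event or disjoint from it.
    by_cases hw : w 0 = i
    · rw [h2 _ hw, h2 _ hw, h.chain.step, mul_assoc]
    · rw [h3 _ hw, h3 _ hw]; simp

theorem Admissible.secondMoment_cond (h : sys.Admissible) {i : Fin N} (hi : 0 < sys.π₀ i)
    (v : Fin d → ℝ) (K : Gain d k N) (t : ℕ) (a b : Fin d) :
    secondMoment (ProbabilityTheory.cond sys.Pr {s | sys.ω 0 s = i})
      (fun s ↦ sys.state K (fun l ↦ sys.ω l s) v t) a b =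
        v ⬝ᵥ ((sys.lyapLin K ^ t) (fun _ ↦ Matrix.single a b 1) i *ᵥ v) := by
  have h1 := (h.condSys hi v).secondMoment_eq K t a b
  have := (h.condSys hi v).prob
  have hx : (sys.condSys i v).x K t = fun s ↦ sys.state K (fun l ↦ sys.ω l s) v t :=
    funext fun s ↦ state_condSys i v K _ v t
  rw [hx] at h1
  refine h1.trans ?_
  change ∑ j, (((Pi.single i 1 : Fin N → ℝ) j • secondMoment (sys.condSys i v).Pr fun _ ↦ v) *
    (sys.lyapLin K ^ t) (fun _ ↦ Matrix.single a b 1) j).trace = _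
  rw [Finset.sum_eq_single i (fun j _ hj ↦ by simp [hj]) (by simp)]
  have h2 : secondMoment (sys.condSys i v).Pr (fun _ ↦ v) = Matrix.vecMulVec v v := by
    ext x y
    simp [secondMoment, Matrix.vecMulVec_apply]
  rw [h2, Pi.single_eq_same, one_smul, Matrix.vecMulVec_mul, Matrix.trace_vecMulVec,
    Matrix.dotProduct_mulVec, dotProduct_comm]

end MJLS

end

/-! ### Mean-square stability as a spectral condition, and the resolvent -/

noncomputable section

theorem PsdFamily.of_hasSum {d N : ℕ} {f : ℕ → Fin N → Matrix (Fin d) (Fin d) ℝ}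
    {V : Fin N → Matrix (Fin d) (Fin d) ℝ} (hf : ∀ t, PsdFamily (f t))
    (h : ∀ i a b, HasSum (fun t ↦ f t i a b) (V i a b)) : PsdFamily V := by
  intro i
  refine Matrix.PosSemidef.of_dotProduct_mulVec_nonneg ?_ fun v ↦ ?_
  · ext a b
    refine (h i b a).unique ?_
    have : (fun t ↦ f t i b a) = fun t ↦ f t i a b := funext fun t ↦ by
      simpa using (hf t i).1.apply a b
    rw [this]
    exact h i a b
  · have h1 : HasSum (fun t ↦ v ⬝ᵥ (f t i *ᵥ v)) (v ⬝ᵥ (V i *ᵥ v)) := by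
      simp only [Matrix.mulVec, dotProduct]
      exact hasSum_sum fun a _ ↦ (hasSum_sum fun b _ ↦ (h i a b).mul_right _).mul_left _
    exact h1.nonneg fun t ↦ by simpa using (hf t i).dotProduct_mulVec_nonneg v

namespace MJLS

variable {d k N : ℕ} {S : Type*} [MeasurableSpace S] {sys : MJLS d k N S}

theorem exists_norm_pow_lt_one (hp : ∀ i j, 0 ≤ sys.p i j) {K : Gain d k N}
    (hK : ∀ i a, Tendsto (fun t : ℕ ↦
      (sys.lyapLin K ^ t) (1 : Fin N → Matrix (Fin d) (Fin d) ℝ) i a a) atTop (𝓝 0)) :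
    ∃ n : ℕ, n ≠ 0 ∧ ‖sys.lyapCLM K ^ n‖ < 1 := by
  -- With this bound on the diagonal of ℒⁿ(1), the norm estimate gives `d / (2 (d + 1)) < 1`.
  have hη : (0 : ℝ) < 1 / (4 * (d + 1)) := by positivity
  have h1 : ∀ᶠ t : ℕ in atTop, ∀ i a,
      (sys.lyapLin K ^ t) (1 : Fin N → Matrix (Fin d) (Fin d) ℝ) i a a < 1 / (4 * (d + 1)) :=
    eventually_all.2 fun i ↦ eventually_all.2 fun a ↦ (hK i a).eventually (gt_mem_nhds hη)
  obtain ⟨n, hn, hn0⟩ := (h1.and (eventually_ne_atTop 0)).exists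
  refine ⟨n, hn0, (sys.norm_lyapCLM_pow_le hp K n hη.le fun i a ↦ (hn i a).le).trans_lt ?_⟩
  have : (0 : ℝ) < d + 1 := by positivity
  rw [mul_one_div, mul_div_assoc', div_lt_one (by positivity)]
  linarith

theorem tendsto_lyapLin_pow {K : Gain d k N} {n : ℕ} (hn : n ≠ 0)
    (hK : ‖sys.lyapCLM K ^ n‖ < 1) (V : Fin N → Matrix (Fin d) (Fin d) ℝ) (i : Fin N)
    (a b : Fin d) : Tendsto (fun t : ℕ ↦ (sys.lyapLin K ^ t) V i a b) atTop (𝓝 0) := by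
  have h1 := (summable_norm_pow_of_norm_pow_lt_one hn hK).tendsto_atTop_zero.mul_const
    ‖familyEquiv d N V‖
  rw [zero_mul] at h1
  refine squeeze_zero_norm (fun t ↦ ?_) h1
  refine le_trans ?_ ((sys.lyapCLM K ^ t).le_opNorm (familyEquiv d N V))
  rw [lyapCLM_pow_apply]
  exact (norm_le_pi_norm (familyEquiv d N _ i a) b).trans
    ((norm_le_pi_norm (familyEquiv d N _ i) a).trans (norm_le_pi_norm _ i))

namespace Admissible

variable (h : sys.Admissible) (hπ : ∀ i, 0 < sys.π₀ i)
include h hπ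

/-- The identity is the sum of the diagonal matrix units, and the `a`-th diagonal entry of ℒᵗ
applied to the `b`-th unit is the second moment of the `b`-th coordinate when starting at the `a`-th
basis vector. -/
theorem tendsto_diag_of_mem {K : Gain d k N} (hK : K ∈ sys.stabilizing) (i : Fin N) (a : Fin d) :
    Tendsto (fun t : ℕ ↦ (sys.lyapLin K ^ t) (1 : Fin N → Matrix (Fin d) (Fin d) ℝ) i a a)
      atTop (𝓝 0) := by
  have h1 : ∀ b, Tendsto (fun t : ℕ ↦ (sys.lyapLin K ^ t) (fun _ ↦ Matrix.single b b 1) i a a)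
      atTop (𝓝 0) := fun b ↦ by
    have h2 : Continuous fun M : Matrix (Fin d) (Fin d) ℝ ↦ M b b :=
      continuous_id.matrix_elem b b
    have h3 := (h2.tendsto 0).comp (hK (Pi.single a 1) i)
    refine h3.congr fun t ↦ ?_
    refine (h.secondMoment_cond (hπ i) _ K t b b).trans ?_
    simp only [Matrix.mulVec_single_one, single_one_dotProduct, Matrix.col_apply]
  have h4 := tendsto_finsetSum Finset.univ fun b _ ↦ h1 b
  rw [Finset.sum_const_zero] at h4
  refine h4.congr fun t ↦ ?_
  have h5 : (1 : Fin N → Matrix (Fin d) (Fin d) ℝ) = ∑ b, fun _ ↦ Matrix.single b b 1 := by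
    ext j x y
    rw [Finset.sum_apply, Matrix.sum_apply, Pi.one_apply, Matrix.one_apply]
    simp [Matrix.single_apply, ite_and]
  rw [h5, map_sum, Finset.sum_apply, Matrix.sum_apply]

theorem mem_stabilizing_of_norm {K : Gain d k N} {n : ℕ} (hn : n ≠ 0)
    (hK : ‖sys.lyapCLM K ^ n‖ < 1) : K ∈ sys.stabilizing := by
  intro v i
  refine tendsto_pi_nhds.2 fun a ↦ tendsto_pi_nhds.2 fun b ↦ ?_
  have h1 : Tendsto (fun t : ℕ ↦ v ⬝ᵥ ((sys.lyapLin K ^ t) (fun _ ↦ Matrix.single a b 1) i *ᵥ v))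
      atTop (𝓝 0) := by
    simp only [Matrix.mulVec, dotProduct]
    have h2 := tendsto_finsetSum Finset.univ fun x _ ↦ (tendsto_finsetSum Finset.univ
      fun y _ ↦ (tendsto_lyapLin_pow hn hK (fun _ ↦ Matrix.single a b 1) i x y).mul_const
        (v y)).const_mul (v x)
    simpa using h2
  exact h1.congr fun t ↦ (h.secondMoment_cond (hπ i) v K t a b).symm

/-- The bridge from probability to operators: for each `n` the right-hand condition is open in `K`,
and it makes the Neumann series converge absolutely. -/
theorem mem_stabilizing_iff_norm {K : Gain d k N} :
    K ∈ sys.stabilizing ↔ ∃ n : ℕ, n ≠ 0 ∧ ‖sys.lyapCLM K ^ n‖ < 1 :=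
  ⟨fun hK ↦ exists_norm_pow_lt_one h.chain.p_nonneg (h.tendsto_diag_of_mem hπ hK),
    fun ⟨_, hn, hK⟩ ↦ h.mem_stabilizing_of_norm hπ hn hK⟩

theorem mem_stabilizing_of_tendsto_diag {K : Gain d k N} (hK : ∀ i a, Tendsto (fun t : ℕ ↦
    (sys.lyapLin K ^ t) (1 : Fin N → Matrix (Fin d) (Fin d) ℝ) i a a) atTop (𝓝 0)) :
    K ∈ sys.stabilizing :=
  (h.mem_stabilizing_iff_norm hπ).2 (exists_norm_pow_lt_one h.chain.p_nonneg hK)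

theorem isOpen_stabilizing : IsOpen sys.stabilizing := by
  have h1 : sys.stabilizing = ⋃ n ∈ {n : ℕ | n ≠ 0}, {K | ‖sys.lyapCLM K ^ n‖ < 1} := by
    ext K
    simp [h.mem_stabilizing_iff_norm hπ]
  rw [h1]
  refine isOpen_biUnion fun n _ ↦ isOpen_lt ?_ continuous_const
  exact ((sys.contDiff_lyapCLM (n := 0)).continuous.pow n).norm

end Admissible

variable (sys) in
/-- The resolvent `(1 - ℒ)⁻¹`. -/
def resolvent (K : Gain d k N) : Module.End ℝ (Fin N → Matrix (Fin d) (Fin d) ℝ) :=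
  (familyEquiv d N).symm.toLinearMap ∘ₗ
    ((Ring.inverse (1 - sys.lyapCLM K)).toLinearMap ∘ₗ (familyEquiv d N).toLinearMap)

theorem isUnit_and_hasSum_inverse {R : Type*} [NormedRing R] [CompleteSpace R] {a : R}
    (ha : Summable fun t : ℕ ↦ ‖a ^ t‖) :
    IsUnit (1 - a) ∧ HasSum (fun t : ℕ ↦ a ^ t) (Ring.inverse (1 - a)) := by
  have hs : Summable fun t : ℕ ↦ a ^ t := ha.of_norm
  let u : Rˣ := ⟨1 - a, ∑' t : ℕ, a ^ t, hs.one_sub_mul_tsum_pow, hs.tsum_pow_mul_one_sub⟩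
  have hu : Ring.inverse (1 - a) = ∑' t : ℕ, a ^ t := Ring.inverse_unit u
  exact ⟨u.isUnit, hu ▸ hs.hasSum⟩

section Resolvent

variable (h : sys.Admissible) (hπ : ∀ i, 0 < sys.π₀ i) {K : Gain d k N} (hK : K ∈ sys.stabilizing)
include h hπ hK

theorem Admissible.isUnit_hasSum : IsUnit (1 - sys.lyapCLM K) ∧
    HasSum (fun t : ℕ ↦ sys.lyapCLM K ^ t) (Ring.inverse (1 - sys.lyapCLM K)) := by
  obtain ⟨n, hn, hK⟩ := (h.mem_stabilizing_iff_norm hπ).1 hK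
  exact isUnit_and_hasSum_inverse (summable_norm_pow_of_norm_pow_lt_one hn hK)

theorem Admissible.hasSum_resolvent_apply (V : Fin N → Matrix (Fin d) (Fin d) ℝ) (i : Fin N)
    (a b : Fin d) : HasSum (fun t : ℕ ↦ (sys.lyapLin K ^ t) V i a b) (sys.resolvent K V i a b) := by
  have h1 := (h.isUnit_hasSum hπ hK).2.mapL
    (ContinuousLinearMap.apply ℝ (Fin N → Fin d → Fin d → ℝ) (familyEquiv d N V))
  have h2 := Pi.hasSum.1 (Pi.hasSum.1 (Pi.hasSum.1 h1 i) a) b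
  simpa only [ContinuousLinearMap.apply_apply, lyapCLM_pow_apply, familyEquiv_apply] using! h2

theorem Admissible.hasSum_resolvent (V : Fin N → Matrix (Fin d) (Fin d) ℝ) :
    HasSum (fun t : ℕ ↦ (sys.lyapLin K ^ t) V) (sys.resolvent K V) :=
  Pi.hasSum.2 fun i ↦ Pi.hasSum.2 fun a ↦ Pi.hasSum.2 fun b ↦
    h.hasSum_resolvent_apply hπ hK V i a b

theorem Admissible.resolvent_sub_lyapOp (V : Fin N → Matrix (Fin d) (Fin d) ℝ) :
    sys.resolvent K (V - sys.lyapOp K V) = V := by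
  have h1 := Ring.inverse_mul_cancel _ (h.isUnit_hasSum hπ hK).1
  have h2 := congrArg (fun f ↦ (familyEquiv d N).symm (f (familyEquiv d N V))) h1
  exact h2

theorem Admissible.resolvent_eq (V : Fin N → Matrix (Fin d) (Fin d) ℝ) :
    sys.resolvent K V = V + sys.lyapOp K (sys.resolvent K V) := by
  have h1 := Ring.mul_inverse_cancel _ (h.isUnit_hasSum hπ hK).1
  have h2 := congrArg (fun f ↦ (familyEquiv d N).symm (f (familyEquiv d N V))) h1
  have h3 : sys.resolvent K V - sys.lyapOp K (sys.resolvent K V) = V := h2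
  exact sub_eq_iff_eq_add.1 h3

theorem Admissible.resolvent_psd {V : Fin N → Matrix (Fin d) (Fin d) ℝ} (hV : PsdFamily V) :
    PsdFamily (sys.resolvent K V) :=
  PsdFamily.of_hasSum (fun t ↦ sys.lyapLin_pow_psd h.chain.p_nonneg K t hV)
    (h.hasSum_resolvent_apply hπ hK V)

/-- Inversion is smooth at units, and ℒ^K is polynomial in `K`. -/
theorem Admissible.contDiffAt_resolvent {V : Gain d k N → Fin N → Matrix (Fin d) (Fin d) ℝ}
    {n : WithTop ℕ∞} (hV : ∀ i a b, ContDiffAt ℝ n (fun K' ↦ V K' i a b) K) (i : Fin N)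
    (a b : Fin d) : ContDiffAt ℝ n (fun K' ↦ sys.resolvent K' (V K') i a b) K := by
  have h1 : ContDiffAt ℝ n (fun K' ↦ familyEquiv d N (V K')) K :=
    contDiffAt_pi.2 fun i ↦ contDiffAt_pi.2 fun a ↦ contDiffAt_pi.2 fun b ↦ hV i a b
  obtain ⟨u, hu⟩ := (h.isUnit_hasSum hπ hK).1
  have h2 : ContDiffAt ℝ n (fun K' ↦ Ring.inverse (1 - sys.lyapCLM K')) K := by
    refine ContDiffAt.comp (g := Ring.inverse) K ?_
      (contDiffAt_const.sub sys.contDiff_lyapCLM.contDiffAt)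
    rw [← hu]
    exact contDiffAt_ringInverse ℝ u
  have h3 := h2.clm_apply h1
  exact contDiffAt_pi.1 (contDiffAt_pi.1 (contDiffAt_pi.1 h3 i) a) b

end Resolvent

end MJLS

end

/-! ### The cost, the correlation matrices and the cost difference formula -/

noncomputable section

theorem exists_pos_forall_le {N : ℕ} {P : Fin N → ℝ → Prop}
    (hmono : ∀ i q q', 0 < q → q ≤ q' → P i q' → P i q) (h : ∀ i, ∃ q, 0 < q ∧ P i q) :
    ∃ q, 0 < q ∧ ∀ i, P i q := by
  choose f hf hP using h
  rcases isEmpty_or_nonempty (Fin N) with hN | hN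
  · exact ⟨1, one_pos, fun i ↦ (IsEmpty.false i).elim⟩
  · obtain ⟨i, hi⟩ := Finite.exists_min f
    exact ⟨f i, hf i, fun j ↦ hmono j _ _ (hf i) (hi j) (hP j)⟩

theorem exists_uniform_sub_smul_one {m N : ℕ} {A : Fin N → Matrix (Fin m) (Fin m) ℝ}
    (hA : ∀ i, (A i).PosDef) :
    ∃ q : ℝ, 0 < q ∧ ∀ i, (A i - q • (1 : Matrix (Fin m) (Fin m) ℝ)).PosSemidef := by
  refine exists_pos_forall_le (fun i q q' _ hq hP ↦ ?_) fun i ↦ (hA i).exists_sub_smul_one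
  have : A i - q • (1 : Matrix (Fin m) (Fin m) ℝ) = (A i - q' • 1) + (q' - q) • 1 := by
    rw [sub_smul]; abel
  rw [this]
  exact hP.add (Matrix.PosSemidef.one.smul (sub_nonneg.2 hq))

theorem Matrix.trace_mul_le_of_sub_posSemidef {m n : ℕ} {A : Matrix (Fin m) (Fin m) ℝ} {q : ℝ}
    (hA : (A - q • (1 : Matrix (Fin m) (Fin m) ℝ)).PosSemidef) (B : Matrix (Fin m) (Fin n) ℝ) :
    q * (Bᵀ * B).trace ≤ (Bᵀ * A * B).trace := by
  have h := (hA.transpose_mul_mul B).trace_nonneg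
  rw [Matrix.mul_sub, Matrix.sub_mul, Matrix.trace_sub] at h
  simpa using h

/-- The increment of `K ↦ Kᵀ R K + (A - B K)ᵀ E (A - B K)`. -/
theorem quadratic_increment {d k : ℕ} (A E : Matrix (Fin d) (Fin d) ℝ)
    (B : Matrix (Fin d) (Fin k) ℝ) (R : Matrix (Fin k) (Fin k) ℝ) (K D : Matrix (Fin k) (Fin d) ℝ)
    (hR : Rᵀ = R) (hE : Eᵀ = E) :
    (K + D)ᵀ * R * (K + D) + (A - B * (K + D))ᵀ * E * (A - B * (K + D)) =
      Kᵀ * R * K + (A - B * K)ᵀ * E * (A - B * K) +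
      (Dᵀ * ((R + Bᵀ * E * B) * K - Bᵀ * E * A) + ((R + Bᵀ * E * B) * K - Bᵀ * E * A)ᵀ * D +
        Dᵀ * (R + Bᵀ * E * B) * D) := by
  simp only [Matrix.transpose_add, Matrix.transpose_sub, Matrix.transpose_mul, hR, hE,
    Matrix.transpose_transpose, Matrix.mul_add, Matrix.add_mul, Matrix.mul_sub, Matrix.sub_mul,
    Matrix.mul_assoc]
  abel

theorem PsdFamily.smul_one_sub {d N : ℕ} {V : Fin N → Matrix (Fin d) (Fin d) ℝ}
    (hV : PsdFamily V) {β : ℝ} (hβ : ∀ i, (V i).trace ≤ β) : PsdFamily (β • 1 - V) := fun i ↦ by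
  have : (β • 1 - V) i = ((V i).trace • (1 : Matrix (Fin d) (Fin d) ℝ) - V i) +
      (β - (V i).trace) • (1 : Matrix (Fin d) (Fin d) ℝ) := by
    simp only [Pi.sub_apply, Pi.smul_apply, Pi.one_apply, sub_smul]; abel
  rw [this]
  exact (hV i).trace_smul_one_sub.add (Matrix.PosSemidef.one.smul (sub_nonneg.2 (hβ i)))

theorem PsdFamily.trace_le_sum {d N : ℕ} {V : Fin N → Matrix (Fin d) (Fin d) ℝ}
    (hV : PsdFamily V) (i : Fin N) : (V i).trace ≤ ∑ j, (V j).trace :=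
  Finset.single_le_sum (f := fun j ↦ (V j).trace) (fun j _ ↦ (hV j).trace_nonneg)
    (Finset.mem_univ i)

namespace MJLS

variable {d k N : ℕ} {S : Type*} [MeasurableSpace S] {sys : MJLS d k N S}

/-- The assumptions of the Markovian jump LQ problem. -/
structure Regular (sys : MJLS d k N S) : Prop extends sys.Admissible where
  Q_pos : ∀ i, (sys.Q i).PosDef
  R_pos : ∀ i, (sys.R i).PosDef
  π_pos : ∀ i, 0 < sys.π₀ i
  cov_pos : (secondMoment sys.Pr sys.x₀).PosDef

variable (sys) in
/-- The running cost matrices `Qᵢ + Kᵢᵀ Rᵢ Kᵢ`. -/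
def runCost (K : Gain d k N) (i : Fin N) : Matrix (Fin d) (Fin d) ℝ :=
  sys.Q i + (K.mat i)ᵀ * sys.R i * K.mat i

variable (sys) in
/-- The functional `V ↦ ∑ᵢ tr (𝐗ᵢ^K Vᵢ)`. -/
def aggregate (K : Gain d k N) : (Fin N → Matrix (Fin d) (Fin d) ℝ) →ₗ[ℝ] ℝ :=
  sys.initPairing ∘ₗ sys.resolvent K

theorem aggregate_apply (K : Gain d k N) (V : Fin N → Matrix (Fin d) (Fin d) ℝ) :
    sys.aggregate K V = sys.initPairing (sys.resolvent K V) := rfl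

namespace Regular

variable (h : sys.Regular)
include h

theorem initCorr_posDef (i : Fin N) : (sys.initCorr i).PosDef := h.cov_pos.smul (h.π_pos i)

theorem initPairing_nonneg {V : Fin N → Matrix (Fin d) (Fin d) ℝ} (hV : PsdFamily V) :
    0 ≤ sys.initPairing V := by
  rw [initPairing_apply]
  exact Finset.sum_nonneg fun i _ ↦ (h.initCorr_posDef i).posSemidef.trace_mul_nonneg (hV i)

/-- The constant is a common lower bound for the eigenvalues of the initial correlations. It does
not involve `K`, which is what makes the later rates uniform. -/
theorem exists_initPairing_lower : ∃ x : ℝ, 0 < x ∧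
    ∀ V : Fin N → Matrix (Fin d) (Fin d) ℝ, PsdFamily V →
      x * ∑ i, (V i).trace ≤ sys.initPairing V := by
  obtain ⟨x, hx, hxi⟩ := exists_uniform_sub_smul_one h.initCorr_posDef
  refine ⟨x, hx, fun V hV ↦ ?_⟩
  rw [Finset.mul_sum, initPairing_apply]
  refine Finset.sum_le_sum fun i _ ↦ ?_
  have h1 := (hxi i).trace_mul_nonneg (hV i)
  rw [Matrix.sub_mul, Matrix.trace_sub] at h1
  simpa using h1

theorem runCost_sub_psd {q : ℝ}
    (hq : ∀ i, (sys.Q i - q • (1 : Matrix (Fin d) (Fin d) ℝ)).PosSemidef) (K : Gain d k N) :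
    PsdFamily (sys.runCost K - q • 1) := fun i ↦ by
  have : (sys.runCost K - q • 1) i =
      (sys.Q i - q • (1 : Matrix (Fin d) (Fin d) ℝ)) + (K.mat i)ᵀ * sys.R i * K.mat i := by
    simp only [Pi.sub_apply, Pi.smul_apply, Pi.one_apply, runCost]; abel
  rw [this]
  exact (hq i).add ((h.R_pos i).posSemidef.transpose_mul_mul _)

theorem runCost_psd (K : Gain d k N) : PsdFamily (sys.runCost K) := fun i ↦
  (h.Q_pos i).posSemidef.add ((h.R_pos i).posSemidef.transpose_mul_mul _)

section Stable

variable {K : Gain d k N} (hK : K ∈ sys.stabilizing)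
include hK

theorem valueMat_eq_resolvent : sys.valueMat K = sys.resolvent K (sys.runCost K) := by
  have h1 := (h.hasSum_resolvent h.π_pos hK (sys.runCost K)).tsum_eq
  simp only [lyapLin_pow_apply] at h1
  exact h1

theorem valueMat_psd : PsdFamily (sys.valueMat K) := by
  rw [h.valueMat_eq_resolvent hK]
  exact h.resolvent_psd h.π_pos hK (h.runCost_psd K)

theorem valueMat_eq : sys.valueMat K = sys.runCost K + sys.lyapOp K (sys.valueMat K) := by
  rw [h.valueMat_eq_resolvent hK]
  exact h.resolvent_eq h.π_pos hK _

theorem hasSum_aggregate (V : Fin N → Matrix (Fin d) (Fin d) ℝ) :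
    HasSum (fun t : ℕ ↦ sys.initPairing ((sys.lyapLin K ^ t) V)) (sys.aggregate K V) := by
  simp only [aggregate_apply, initPairing_apply, Matrix.trace, Matrix.diag_apply, Matrix.mul_apply]
  exact hasSum_sum fun i _ ↦ hasSum_sum fun a _ ↦ hasSum_sum fun b _ ↦
    (h.hasSum_resolvent_apply h.π_pos hK V i b a).mul_left _

theorem aggregate_nonneg {V : Fin N → Matrix (Fin d) (Fin d) ℝ} (hV : PsdFamily V) :
    0 ≤ sys.aggregate K V := h.initPairing_nonneg (h.resolvent_psd h.π_pos hK hV)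

/-- The left side is the term `t = 0` of a series with nonnegative terms. -/
theorem initPairing_le_aggregate {V : Fin N → Matrix (Fin d) (Fin d) ℝ} (hV : PsdFamily V) :
    sys.initPairing V ≤ sys.aggregate K V := by
  rw [aggregate_apply, h.resolvent_eq h.π_pos hK, map_add, le_add_iff_nonneg_right]
  exact h.initPairing_nonneg
    (sys.lyapOp_psd h.chain.p_nonneg K (h.resolvent_psd h.π_pos hK hV))

theorem aggregate_le {V : Fin N → Matrix (Fin d) (Fin d) ℝ} (hV : PsdFamily V) :
    sys.aggregate K V ≤ (∑ i, (V i).trace) * sys.aggregate K 1 := by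
  have h1 := hV.smul_one_sub hV.trace_le_sum
  have h2 := h.aggregate_nonneg hK h1
  rw [map_sub, map_smul, smul_eq_mul] at h2
  exact sub_nonneg.1 h2

/-- The running costs are nonnegative, so sum and expectation may be exchanged; each expectation is
then given by the moment formula. -/
theorem cost_eq : sys.cost K = ENNReal.ofReal (sys.aggregate K (sys.runCost K)) := by
  have h1 : ∀ t s, sys.x K t s ⬝ᵥ (sys.Q (sys.ω t s) *ᵥ sys.x K t s) +
      sys.u K t s ⬝ᵥ (sys.R (sys.ω t s) *ᵥ sys.u K t s) =
      sys.x K t s ⬝ᵥ (sys.runCost K (sys.ω t s) *ᵥ sys.x K t s) := by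
    intro t s
    rw [runCost, Matrix.add_mulVec, dotProduct_add, ← Matrix.mulVec_mulVec,
      ← Matrix.mulVec_mulVec, Matrix.dotProduct_mulVec _ (_)ᵀ, Matrix.vecMul_transpose, u,
      Matrix.mulVec_neg, neg_dotProduct_neg]
  have h2 : ∀ t s, 0 ≤ sys.x K t s ⬝ᵥ (sys.runCost K (sys.ω t s) *ᵥ sys.x K t s) := fun t s ↦ by
    simpa using (h.runCost_psd K (sys.ω t s)).dotProduct_mulVec_nonneg (sys.x K t s)
  have h3 : ∀ t, Integrable
      (fun s ↦ sys.x K t s ⬝ᵥ (sys.runCost K (sys.ω t s) *ᵥ sys.x K t s)) sys.Pr :=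
    fun t ↦ h.integrable_quad_mode K t t _
  simp only [cost, h1]
  rw [lintegral_tsum fun t ↦ (h3 t).aestronglyMeasurable.aemeasurable.ennreal_ofReal]
  simp only [← ofReal_integral_eq_lintegral_ofReal (h3 _) (ae_of_all _ (h2 _)), h.integral_quad]
  have h4 := h.hasSum_aggregate hK (sys.runCost K)
  rw [← ENNReal.ofReal_tsum_of_nonneg (fun t ↦ h.initPairing_nonneg
    (sys.lyapLin_pow_psd h.chain.p_nonneg K t (h.runCost_psd K))) h4.summable, h4.tsum_eq]

theorem costReal_eq : sys.costReal K = sys.aggregate K (sys.runCost K) := by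
  rw [costReal, h.cost_eq hK, ENNReal.toReal_ofReal (h.aggregate_nonneg hK (h.runCost_psd K))]

theorem costReal_eq_initPairing : sys.costReal K = sys.initPairing (sys.valueMat K) := by
  rw [h.costReal_eq hK, h.valueMat_eq_resolvent hK, aggregate_apply]

theorem hasSum_corrMat_apply (i : Fin N) (a b : Fin d) :
    HasSum (fun t : ℕ ↦ secondMoment (sys.Pr.restrict {s | sys.ω t s = i}) (sys.x K t) a b)
      (sys.aggregate K (Pi.single i (Matrix.single a b 1))) := by
  simp only [h.secondMoment_restrict]
  exact h.hasSum_aggregate hK _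

theorem corrMat_apply (i : Fin N) (a b : Fin d) :
    sys.corrMat K i a b = sys.aggregate K (Pi.single i (Matrix.single a b 1)) := by
  have h1 : HasSum (fun t : ℕ ↦ secondMoment (sys.Pr.restrict {s | sys.ω t s = i}) (sys.x K t))
      (Matrix.of fun a b ↦ sys.aggregate K (Pi.single i (Matrix.single a b 1))) :=
    Pi.hasSum.2 fun a ↦ Pi.hasSum.2 fun b ↦ h.hasSum_corrMat_apply hK i a b
  rw [corrMat, h1.tsum_eq, Matrix.of_apply]

theorem corrMat_transpose (i : Fin N) : (sys.corrMat K i)ᵀ = sys.corrMat K i := by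
  ext a b
  rw [Matrix.transpose_apply, h.corrMat_apply hK, h.corrMat_apply hK]
  refine (h.hasSum_corrMat_apply hK i b a).unique ?_
  have : (fun t : ℕ ↦ secondMoment (sys.Pr.restrict {s | sys.ω t s = i}) (sys.x K t) b a) =
      fun t : ℕ ↦ secondMoment (sys.Pr.restrict {s | sys.ω t s = i}) (sys.x K t) a b := by
    funext t
    simp only [secondMoment, Matrix.of_apply, mul_comm]
  rw [this]
  exact h.hasSum_corrMat_apply hK i a b

theorem aggregate_eq_sum (V : Fin N → Matrix (Fin d) (Fin d) ℝ) :
    sys.aggregate K V = ∑ i, (sys.corrMat K i * V i).trace := by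
  have h1 : V = ∑ i, ∑ a, ∑ b, V i a b • Pi.single i (Matrix.single a b (1 : ℝ)) := by
    ext j x y
    simp only [Finset.sum_apply, Matrix.sum_apply, Pi.smul_apply, Matrix.smul_apply, smul_eq_mul]
    rw [Finset.sum_eq_single j (fun i _ hi ↦ by simp [hi.symm]) (by simp),
      Finset.sum_eq_single x (fun a _ ha ↦ by simp [ha]) (by simp),
      Finset.sum_eq_single y (fun b _ hb ↦ by simp [hb]) (by simp)]
    simp
  conv_lhs => rw [h1]
  simp only [map_sum, map_smul, smul_eq_mul, Matrix.trace, Matrix.diag_apply, Matrix.mul_apply]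
  refine Finset.sum_congr rfl fun i _ ↦ ?_
  rw [Finset.sum_comm]
  refine Finset.sum_congr rfl fun b _ ↦ Finset.sum_congr rfl fun a _ ↦ ?_
  rw [← h.corrMat_apply hK, ← h.corrMat_transpose hK i, Matrix.transpose_apply, mul_comm,
    h.corrMat_transpose hK i]

/-- The correlations dominate their term at time 0, as one sees by testing with the family that is v
vᵀ in mode `i` and 0 elsewhere. -/
theorem corrMat_posDef (i : Fin N) : (sys.corrMat K i).PosDef := by
  refine Matrix.PosDef.of_dotProduct_mulVec_pos ?_ fun v hv ↦ ?_
  · rw [Matrix.IsHermitian, Matrix.conjTranspose_eq_transpose_of_trivial, h.corrMat_transpose hK]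
  have key : ∀ X : Fin N → Matrix (Fin d) (Fin d) ℝ,
      ∑ j, (X j * (Pi.single i (Matrix.vecMulVec v v) : Fin N → Matrix (Fin d) (Fin d) ℝ) j).trace =
        v ⬝ᵥ (X i *ᵥ v) := fun X ↦ by
    rw [Finset.sum_eq_single i (fun j _ hj ↦ by simp [hj]) (by simp), Pi.single_eq_same,
      Matrix.mul_vecMulVec, Matrix.trace_vecMulVec, dotProduct_comm]
  have h1 : PsdFamily (Pi.single i (Matrix.vecMulVec v v) : Fin N → Matrix (Fin d) (Fin d) ℝ) := by
    intro j
    rcases eq_or_ne j i with rfl | hj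
    · rw [Pi.single_eq_same]
      simpa using Matrix.posSemidef_vecMulVec_self_star v
    · rw [Pi.single_eq_of_ne hj]; exact Matrix.PosSemidef.zero
  have h2 := h.initPairing_le_aggregate hK h1
  rw [h.aggregate_eq_sum hK, initPairing_apply, key, key] at h2
  have h3 := (h.initCorr_posDef i).dotProduct_mulVec_pos hv
  simp only [star_trivial] at h3 ⊢
  exact h3.trans_le h2

theorem psi_posDef (i : Fin N) : (sys.psi (sys.valueMat K) i).PosDef :=
  (h.R_pos i).add_posSemidef
    ((sys.expOp_posSemidef h.chain.p_nonneg (h.valueMat_psd hK) i).transpose_mul_mul _)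

end Stable

end Regular

variable (sys) in
/-- The second-order expansion of the running cost-to-go around `K` in direction `D`. -/
def increment (K : Gain d k N) (D : Fin N → Matrix (Fin k) (Fin d) ℝ) (i : Fin N) :
    Matrix (Fin d) (Fin d) ℝ :=
  (D i)ᵀ * sys.lMat K i + (sys.lMat K i)ᵀ * D i + (D i)ᵀ * sys.psi (sys.valueMat K) i * D i

/-- Since P^K is the resolvent of `K'` applied to P^K - ℒ^{K'}(P^K), both costs are aggregates under
the same gain `K'`. The integrands are then compared exactly, by the Lyapunov equation for `K` and
the expansion of a quadratic. -/
theorem Regular.costReal_sub (h : sys.Regular) {K K' : Gain d k N} (hK : K ∈ sys.stabilizing)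
    (hK' : K' ∈ sys.stabilizing) :
    sys.costReal K' - sys.costReal K =
      sys.aggregate K' (sys.increment K fun i ↦ K'.mat i - K.mat i) := by
  have h1 : sys.costReal K =
      sys.aggregate K' (sys.valueMat K - sys.lyapOp K' (sys.valueMat K)) := by
    rw [aggregate_apply, h.resolvent_sub_lyapOp h.π_pos hK', h.costReal_eq_initPairing hK]
  rw [h1, h.costReal_eq hK', ← map_sub]
  congr 1
  ext1 i
  have h2 : (sys.R i)ᵀ = sys.R i := by
    simpa [Matrix.conjTranspose_eq_transpose_of_trivial] using (h.R_pos i).1.eq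
  have h3 : (sys.expOp (sys.valueMat K) i)ᵀ = sys.expOp (sys.valueMat K) i := by
    simpa [Matrix.conjTranspose_eq_transpose_of_trivial] using
      (sys.expOp_posSemidef h.chain.p_nonneg (h.valueMat_psd hK) i).1.eq
  have h4 := quadratic_increment (sys.A i) (sys.expOp (sys.valueMat K) i) (sys.B i) (sys.R i)
    (K.mat i) (K'.mat i - K.mat i) h2 h3
  rw [add_sub_cancel] at h4
  have h5 := congrFun (h.valueMat_eq hK) i
  simp only [Pi.sub_apply, Pi.add_apply, runCost, lyapOp, closedLoop, increment, lMat, psi]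
    at h4 h5 ⊢
  rw [eq_comm, ← sub_eq_iff_eq_add'] at h4
  rw [← h4]
  conv_lhs => rw [h5]
  abel

end MJLS

end

/-! ### Smoothness in the gain and the gradient of the cost -/

noncomputable section

section MatrixSmooth

variable {E : Type*} [NormedAddCommGroup E] [NormedSpace ℝ E] {n : WithTop ℕ∞} {x : E}

theorem ContDiffAt.matrix_mul_apply {l m p : ℕ} {A : E → Matrix (Fin l) (Fin m) ℝ}
    {B : E → Matrix (Fin m) (Fin p) ℝ} (hA : ∀ a b, ContDiffAt ℝ n (fun y ↦ A y a b) x)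
    (hB : ∀ a b, ContDiffAt ℝ n (fun y ↦ B y a b) x) (a : Fin l) (b : Fin p) :
    ContDiffAt ℝ n (fun y ↦ (A y * B y) a b) x := by
  simp only [Matrix.mul_apply]
  exact ContDiffAt.sum fun c _ ↦ (hA a c).mul (hB c b)

theorem ContDiffAt.matrix_const_mul_mul_apply {l m p q : ℕ} (C : Matrix (Fin l) (Fin m) ℝ)
    {A : E → Matrix (Fin m) (Fin p) ℝ} (D : Matrix (Fin p) (Fin q) ℝ)
    (hA : ∀ a b, ContDiffAt ℝ n (fun y ↦ A y a b) x) (a : Fin l) (b : Fin q) :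
    ContDiffAt ℝ n (fun y ↦ (C * A y * D) a b) x :=
  ContDiffAt.matrix_mul_apply (A := fun y ↦ C * A y) (B := fun _ ↦ D)
    (ContDiffAt.matrix_mul_apply (A := fun _ ↦ C) (fun _ _ ↦ contDiffAt_const) hA)
    (fun _ _ ↦ contDiffAt_const) a b

theorem ContDiffAt.matrix_det {m : ℕ} {A : E → Matrix (Fin m) (Fin m) ℝ}
    (hA : ∀ a b, ContDiffAt ℝ n (fun y ↦ A y a b) x) : ContDiffAt ℝ n (fun y ↦ (A y).det) x := by
  simp only [Matrix.det_apply']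
  exact ContDiffAt.sum fun σ _ ↦ contDiffAt_const.mul (contDiffAt_prod fun i _ ↦ hA _ _)

theorem ContDiffAt.matrix_inv_apply {m : ℕ} {A : E → Matrix (Fin m) (Fin m) ℝ}
    (hA : ∀ a b, ContDiffAt ℝ n (fun y ↦ A y a b) x) (hx : IsUnit (A x)) (a b : Fin m) :
    ContDiffAt ℝ n (fun y ↦ (A y)⁻¹ a b) x := by
  have hdet : (A x).det ≠ 0 := ((Matrix.isUnit_iff_isUnit_det _).1 hx).ne_zero
  simp only [Matrix.inv_def, Ring.inverse_eq_inv', Matrix.smul_apply, smul_eq_mul,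
    Matrix.adjugate_apply]
  refine ((ContDiffAt.matrix_det hA).inv hdet).mul (ContDiffAt.matrix_det fun c e ↦ ?_)
  by_cases hc : c = b
  · subst hc; simpa using contDiffAt_const
  · simpa [Matrix.updateRow_ne hc] using hA c e

end MatrixSmooth

namespace Gain

variable {d k N : ℕ}

@[simp] theorem mat_ofMat (M : Fin N → Matrix (Fin k) (Fin d) ℝ) (i : Fin N) :
    (ofMat M).mat i = M i := rfl

theorem ofMat_mat (K : Gain d k N) : ofMat K.mat = K := rfl

theorem mat_sub (K K' : Gain d k N) (i : Fin N) : (K - K').mat i = K.mat i - K'.mat i := rfl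

theorem mat_smul (c : ℝ) (K : Gain d k N) (i : Fin N) : (c • K).mat i = c • K.mat i := rfl

theorem mat_injective {K K' : Gain d k N} (h : ∀ i, K.mat i = K'.mat i) : K = K' := by
  rw [← ofMat_mat K, ← ofMat_mat K', funext h]

theorem inner_eq (K K' : Gain d k N) : inner ℝ K K' = ∑ i, ((K.mat i)ᵀ * K'.mat i).trace := by
  rw [PiLp.inner_apply, Fintype.sum_prod_type]
  refine Finset.sum_congr rfl fun i _ ↦ ?_
  rw [Fintype.sum_prod_type, Finset.sum_comm]
  simp [Matrix.trace, Matrix.mul_apply, mat, mul_comm]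

theorem norm_sq_eq (K : Gain d k N) : ‖K‖ ^ 2 = ∑ i, ((K.mat i)ᵀ * K.mat i).trace := by
  rw [← inner_eq, real_inner_self_eq_norm_sq]

theorem contDiffAt_ofMat {E : Type*} [NormedAddCommGroup E] [NormedSpace ℝ E] {n : WithTop ℕ∞}
    {x : E} {M : E → Fin N → Matrix (Fin k) (Fin d) ℝ}
    (hM : ∀ i a b, ContDiffAt ℝ n (fun y ↦ M y i a b) x) :
    ContDiffAt ℝ n (fun y ↦ (ofMat (M y) : Gain d k N)) x :=
  contDiffAt_piLp 2 |>.2 fun q ↦ hM q.1 q.2.1 q.2.2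

theorem contDiff_mat_apply {n : WithTop ℕ∞} (i : Fin N) (a : Fin k) (b : Fin d) :
    ContDiff ℝ n fun K : Gain d k N ↦ K.mat i a b := by
  simp only [mat, Matrix.of_apply]
  fun_prop

end Gain

/-- The difference quotient at 0 is `g` itself, so continuity of `g` suffices. Applied to the cost
difference formula, this gives the gradient without differentiating the resolvent. -/
theorem hasDerivAt_const_add_mul {g : ℝ → ℝ} (c : ℝ) (hg : ContinuousAt g 0) :
    HasDerivAt (fun s ↦ c + s * g s) (g 0) 0 := by
  rw [hasDerivAt_iff_tendsto_slope]
  refine (hg.tendsto.mono_left nhdsWithin_le_nhds).congr' ?_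
  filter_upwards [self_mem_nhdsWithin] with s hs
  have hs' : s ≠ 0 := hs
  rw [slope_def_field]
  field_simp
  ring

namespace MJLS

variable {d k N : ℕ} {S : Type*} [MeasurableSpace S] {sys : MJLS d k N S}

variable (sys) in
/-- The tuple `2 L^K 𝐗^K`. -/
def gradTuple (K : Gain d k N) : Gain d k N :=
  Gain.ofMat fun i ↦ (2 : ℝ) • (sys.lMat K i * sys.corrMat K i)

namespace Regular

variable (h : sys.Regular) {K : Gain d k N} (hK : K ∈ sys.stabilizing)
include h hK

theorem contDiffAt_aggregate {V : Gain d k N → Fin N → Matrix (Fin d) (Fin d) ℝ}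
    {n : WithTop ℕ∞} (hV : ∀ i a b, ContDiffAt ℝ n (fun K' ↦ V K' i a b) K) :
    ContDiffAt ℝ n (fun K' ↦ sys.aggregate K' (V K')) K := by
  simp only [aggregate_apply, initPairing_apply, Matrix.trace, Matrix.diag_apply, Matrix.mul_apply]
  exact ContDiffAt.sum fun i _ ↦ ContDiffAt.sum fun a _ ↦ ContDiffAt.sum fun b _ ↦
    contDiffAt_const.mul (h.contDiffAt_resolvent h.π_pos hK hV i b a)

theorem continuousAt_aggregate (V : Fin N → Matrix (Fin d) (Fin d) ℝ) :
    ContinuousAt (fun K' ↦ sys.aggregate K' V) K :=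
  (h.contDiffAt_aggregate hK (V := fun _ ↦ V) (n := 0) fun _ _ _ ↦ contDiffAt_const).continuousAt

omit h hK in
theorem contDiffAt_runCost {n : WithTop ℕ∞} (i : Fin N) (a b : Fin d) :
    ContDiffAt ℝ n (fun K' ↦ sys.runCost K' i a b) K := by
  simp only [runCost, Matrix.add_apply]
  refine contDiffAt_const.add (ContDiffAt.matrix_mul_apply (ContDiffAt.matrix_mul_apply ?_ ?_) ?_ a b)
  · exact fun a b ↦ (Gain.contDiff_mat_apply i b a).contDiffAt
  · exact fun _ _ ↦ contDiffAt_const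
  · exact fun a b ↦ (Gain.contDiff_mat_apply i a b).contDiffAt

theorem eventually_mem : ∀ᶠ K' in 𝓝 K, K' ∈ sys.stabilizing :=
  (h.isOpen_stabilizing h.π_pos).mem_nhds hK

theorem contDiffAt_costReal {n : WithTop ℕ∞} : ContDiffAt ℝ n sys.costReal K := by
  refine (h.contDiffAt_aggregate hK (contDiffAt_runCost (sys := sys))).congr_of_eventuallyEq ?_
  filter_upwards [h.eventually_mem hK] with K' hK' using h.costReal_eq hK'

theorem contDiffAt_valueMat {n : WithTop ℕ∞} (i : Fin N) (a b : Fin d) :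
    ContDiffAt ℝ n (fun K' ↦ sys.valueMat K' i a b) K := by
  refine (h.contDiffAt_resolvent h.π_pos hK (contDiffAt_runCost (sys := sys)) i a b).congr_of_eventuallyEq ?_
  filter_upwards [h.eventually_mem hK] with K' hK'
  rw [h.valueMat_eq_resolvent hK']

theorem contDiffAt_expOp {n : WithTop ℕ∞} (i : Fin N) (a b : Fin d) :
    ContDiffAt ℝ n (fun K' ↦ sys.expOp (sys.valueMat K') i a b) K := by
  simp only [expOp, Matrix.sum_apply, Matrix.smul_apply, smul_eq_mul]
  exact ContDiffAt.sum fun j _ ↦ contDiffAt_const.mul (h.contDiffAt_valueMat hK j a b)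

theorem contDiffAt_psi {n : WithTop ℕ∞} (i : Fin N) (a b : Fin k) :
    ContDiffAt ℝ n (fun K' ↦ sys.psi (sys.valueMat K') i a b) K := by
  simp only [psi, Matrix.add_apply]
  exact contDiffAt_const.add
    (ContDiffAt.matrix_const_mul_mul_apply _ _ (h.contDiffAt_expOp hK i) a b)

theorem contDiffAt_lMat {n : WithTop ℕ∞} (i : Fin N) (a : Fin k) (b : Fin d) :
    ContDiffAt ℝ n (fun K' ↦ sys.lMat K' i a b) K := by
  simp only [lMat, Matrix.sub_apply]
  refine ContDiffAt.sub (ContDiffAt.matrix_mul_apply (h.contDiffAt_psi hK i)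
    (fun a b ↦ (Gain.contDiff_mat_apply i a b).contDiffAt) a b) ?_
  exact ContDiffAt.matrix_const_mul_mul_apply _ _ (h.contDiffAt_expOp hK i) a b

theorem contDiffAt_corrMat {n : WithTop ℕ∞} (i : Fin N) (a b : Fin d) :
    ContDiffAt ℝ n (fun K' ↦ sys.corrMat K' i a b) K := by
  refine (h.contDiffAt_aggregate hK (V := fun _ ↦ Pi.single i (Matrix.single a b 1))
    fun _ _ _ ↦ contDiffAt_const).congr_of_eventuallyEq ?_
  filter_upwards [h.eventually_mem hK] with K' hK' using h.corrMat_apply hK' i a b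

theorem contDiffAt_gradTuple {n : WithTop ℕ∞} : ContDiffAt ℝ n sys.gradTuple K :=
  Gain.contDiffAt_ofMat fun i a b ↦ by
    simp only [Matrix.smul_apply, smul_eq_mul]
    exact contDiffAt_const.mul (ContDiffAt.matrix_mul_apply (h.contDiffAt_lMat hK i)
      (h.contDiffAt_corrMat hK i) a b)

theorem inner_gradTuple (H : Gain d k N) : inner ℝ (sys.gradTuple K) H =
    sys.aggregate K fun i ↦ (H.mat i)ᵀ * sys.lMat K i + (sys.lMat K i)ᵀ * H.mat i := by
  rw [Gain.inner_eq, h.aggregate_eq_sum hK]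
  refine Finset.sum_congr rfl fun i _ ↦ ?_
  have h1 : (sys.corrMat K i * ((H.mat i)ᵀ * sys.lMat K i)).trace =
      (sys.corrMat K i * ((sys.lMat K i)ᵀ * H.mat i)).trace := by
    rw [← Matrix.trace_transpose]
    simp only [Matrix.transpose_mul, Matrix.transpose_transpose, h.corrMat_transpose hK]
    rw [Matrix.trace_mul_comm]
  rw [Matrix.mul_add, Matrix.trace_add, h1, gradTuple, Gain.mat_ofMat, Matrix.transpose_smul,
    Matrix.transpose_mul, h.corrMat_transpose hK, Matrix.smul_mul, Matrix.trace_smul,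
    Matrix.mul_assoc, smul_eq_mul, two_mul]

/-- Differentiability is already known, so directional derivatives suffice. Along K + sH the cost
difference is `s` times an aggregate at K + sH of `V₁ + s V₂`, whose limit as `s` tends to 0 is the
pairing of the gradient tuple with `H`. -/
theorem hasGradientAt_costReal : HasGradientAt sys.costReal (sys.gradTuple K) K := by
  have hd : DifferentiableAt ℝ sys.costReal K :=
    (h.contDiffAt_costReal hK (n := 1)).differentiableAt one_ne_zero
  suffices hg : InnerProductSpace.toDual ℝ (Gain d k N) (sys.gradTuple K) =
      fderiv ℝ sys.costReal K by
    rw [hasGradientAt_iff_hasFDerivAt, hg]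
    exact hd.hasFDerivAt
  ext1 H
  rw [InnerProductSpace.toDual_apply_apply, h.inner_gradTuple hK]
  set V₁ : Fin N → Matrix (Fin d) (Fin d) ℝ :=
    fun i ↦ (H.mat i)ᵀ * sys.lMat K i + (sys.lMat K i)ᵀ * H.mat i with hV₁
  set V₂ : Fin N → Matrix (Fin d) (Fin d) ℝ :=
    fun i ↦ (H.mat i)ᵀ * sys.psi (sys.valueMat K) i * H.mat i with hV₂
  have hline : HasDerivAt (fun s : ℝ ↦ K + s • H) H 0 := by
    simpa using ((hasDerivAt_id (0 : ℝ)).smul_const H).const_add K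
  have h0 : K + (0 : ℝ) • H = K := by simp
  have hd1 : HasDerivAt (fun s : ℝ ↦ sys.costReal (K + s • H)) (fderiv ℝ sys.costReal K H) 0 :=
    hd.hasFDerivAt.hasLineDerivAt H
  have hcont : ∀ V, ContinuousAt (fun s : ℝ ↦ sys.aggregate (K + s • H) V) 0 := fun V ↦ by
    refine ContinuousAt.comp (f := fun s : ℝ ↦ K + s • H) (g := fun K' ↦ sys.aggregate K' V) ?_
      hline.continuousAt
    rw [h0]
    exact h.continuousAt_aggregate hK V
  have hd2 := hasDerivAt_const_add_mul (sys.costReal K)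
    ((hcont V₁).add (continuousAt_id.mul (hcont V₂)))
  simp only [Pi.add_apply, Pi.mul_apply, id, h0, zero_mul, add_zero] at hd2
  refine (hd2.congr_of_eventuallyEq ?_).unique hd1
  have hev : ∀ᶠ s : ℝ in 𝓝 0, K + s • H ∈ sys.stabilizing := by
    refine hline.continuousAt.eventually ?_
    simpa only [h0] using h.eventually_mem hK
  filter_upwards [hev] with s hs
  rw [← sub_eq_iff_eq_add', h.costReal_sub hK hs]
  have hinc : (sys.increment K fun i ↦ (K + s • H).mat i - K.mat i) = s • (V₁ + s • V₂) := by
    ext1 i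
    have : (K + s • H).mat i - K.mat i = s • H.mat i := by
      rw [← Gain.mat_sub, add_sub_cancel_left, Gain.mat_smul]
    simp only [increment, this, hV₁, hV₂, Pi.smul_apply, Pi.add_apply, Matrix.transpose_smul,
      Matrix.smul_mul, Matrix.mul_smul, smul_add, smul_smul]
  rw [hinc, map_smul, map_add, map_smul]
  rfl

end Regular

end MJLS

end

/-! ### Gradient dominance and compactness of sublevel sets -/

noncomputable section

namespace MJLS

variable {d k N : ℕ} {S : Type*} [MeasurableSpace S] {sys : MJLS d k N S}

variable (sys) in
/-- The matrices `G = Ψ⁻¹ L`. -/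
def newtonMat (K : Gain d k N) (i : Fin N) : Matrix (Fin k) (Fin d) ℝ :=
  (sys.psi (sys.valueMat K) i)⁻¹ * sys.lMat K i

variable (sys) in
/-- The matrices `Gᵀ Ψ G = Lᵀ Ψ⁻¹ L`. -/
def newtonDecrement (K : Gain d k N) (i : Fin N) : Matrix (Fin d) (Fin d) ℝ :=
  (sys.newtonMat K i)ᵀ * sys.psi (sys.valueMat K) i * sys.newtonMat K i

namespace Regular

variable (h : sys.Regular) {K : Gain d k N} (hK : K ∈ sys.stabilizing)
include h hK

theorem psi_mul_newtonMat (i : Fin N) :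
    sys.psi (sys.valueMat K) i * sys.newtonMat K i = sys.lMat K i :=
  Matrix.mul_nonsing_inv_cancel_left _ _
    ((Matrix.isUnit_iff_isUnit_det _).1 (h.psi_posDef hK i).isUnit)

theorem psi_transpose (i : Fin N) :
    (sys.psi (sys.valueMat K) i)ᵀ = sys.psi (sys.valueMat K) i := by
  simpa [Matrix.conjTranspose_eq_transpose_of_trivial] using (h.psi_posDef hK i).1.eq

theorem newtonDecrement_psd : PsdFamily (sys.newtonDecrement K) :=
  fun i ↦ (h.psi_posDef hK i).posSemidef.transpose_mul_mul _

theorem newtonDecrement_eq (i : Fin N) :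
    sys.newtonDecrement K i = (sys.newtonMat K i)ᵀ * sys.lMat K i := by
  rw [newtonDecrement, Matrix.mul_assoc, h.psi_mul_newtonMat hK]

theorem newtonDecrement_eq' (i : Fin N) :
    sys.newtonDecrement K i = (sys.lMat K i)ᵀ * sys.newtonMat K i := by
  rw [newtonDecrement, ← h.psi_mul_newtonMat hK i, Matrix.transpose_mul, h.psi_transpose hK]

/-- Completing the square: the sum is (D + G)ᵀΨ(D + G) with G = Ψ⁻¹L, so the decrement is the
largest gain any `D` can achieve. -/
theorem increment_add_newtonDecrement (D : Fin N → Matrix (Fin k) (Fin d) ℝ) :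
    PsdFamily (sys.increment K D + sys.newtonDecrement K) := by
  intro i
  have h1 : (sys.increment K D + sys.newtonDecrement K) i =
      (D i + sys.newtonMat K i)ᵀ * sys.psi (sys.valueMat K) i * (D i + sys.newtonMat K i) := by
    rw [Pi.add_apply, increment, newtonDecrement, ← h.psi_mul_newtonMat hK i]
    simp only [Matrix.transpose_add, Matrix.transpose_mul, h.psi_transpose hK, Matrix.add_mul,
      Matrix.mul_add, Matrix.mul_assoc]
    abel
  rw [h1]
  exact (h.psi_posDef hK i).posSemidef.transpose_mul_mul _

/-- The cost difference formula is used with the aggregate of `K'`. When `K'` is a fixed reference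
gain, the last factor is a constant independent of `K`. -/
theorem costReal_sub_le {K' : Gain d k N} (hK' : K' ∈ sys.stabilizing) :
    sys.costReal K - sys.costReal K' ≤
      (∑ i, (sys.newtonDecrement K i).trace) * sys.aggregate K' 1 := by
  refine le_trans ?_ (h.aggregate_le hK' (h.newtonDecrement_psd hK))
  have h1 := h.aggregate_nonneg hK' (h.increment_add_newtonDecrement hK
    fun i ↦ K'.mat i - K.mat i)
  rw [map_add, ← h.costReal_sub hK hK'] at h1
  linarith

theorem psi_sub_psd {r : ℝ}
    (hr : ∀ i, (sys.R i - r • (1 : Matrix (Fin k) (Fin k) ℝ)).PosSemidef) (i : Fin N) :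
    (sys.psi (sys.valueMat K) i - r • (1 : Matrix (Fin k) (Fin k) ℝ)).PosSemidef := by
  rw [psi, add_sub_right_comm]
  exact (hr i).add ((sys.expOp_posSemidef h.chain.p_nonneg (h.valueMat_psd hK) i).transpose_mul_mul _)

theorem trace_newtonDecrement_le {r : ℝ} (hr0 : 0 < r)
    (hr : ∀ i, (sys.R i - r • (1 : Matrix (Fin k) (Fin k) ℝ)).PosSemidef) (i : Fin N) :
    r * (sys.newtonDecrement K i).trace ≤ ((sys.lMat K i)ᵀ * sys.lMat K i).trace := by
  have h1 := Matrix.trace_mul_le_of_sub_posSemidef (h.psi_sub_psd hK hr i) (sys.newtonMat K i)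
  -- Expanding gives 2r tr(GᵀΨG) ≤ tr(LᵀL) + r² tr(GᵀG), and `h1` absorbs the last term into r
  -- tr(GᵀΨG).
  have h2 : 0 ≤ ((sys.lMat K i - r • sys.newtonMat K i)ᵀ *
      (sys.lMat K i - r • sys.newtonMat K i)).trace :=
    (Matrix.posSemidef_transpose_mul_self _).trace_nonneg
  simp only [Matrix.transpose_sub, Matrix.transpose_smul, Matrix.sub_mul, Matrix.mul_sub,
    Matrix.smul_mul, Matrix.mul_smul, Matrix.trace_sub, Matrix.trace_smul, smul_eq_mul,
    ← h.newtonDecrement_eq hK, ← h.newtonDecrement_eq' hK] at h2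
  have h3 : r * ((sys.newtonMat K i)ᵀ * sys.newtonMat K i).trace ≤
      (sys.newtonDecrement K i).trace := h1
  nlinarith

theorem gradField_eq : sys.gradField K = -sys.gradTuple K := by
  rw [gradField, (h.hasGradientAt_costReal hK).gradient]

omit h hK in
theorem gaussNewtonField_eq :
    sys.gaussNewtonField K = Gain.ofMat fun i ↦ (-2 : ℝ) • sys.newtonMat K i := by
  rw [gaussNewtonField]
  congr 1
  ext1 i
  rw [neg_smul]; rfl

theorem natGradField_eq :
    sys.natGradField K = Gain.ofMat fun i ↦ (-2 : ℝ) • sys.lMat K i := by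
  rw [natGradField, (h.hasGradientAt_costReal hK).gradient]
  congr 1
  ext1 i
  rw [gradTuple, Gain.mat_ofMat, Matrix.smul_mul, Matrix.mul_nonsing_inv_cancel_right _ _
    ((Matrix.isUnit_iff_isUnit_det _).1 (h.corrMat_posDef hK i).isUnit), neg_smul]

omit hK in
theorem contDiffOn_gradField : ContDiffOn ℝ 1 sys.gradField sys.stabilizing :=
  ContDiffOn.congr (f := fun K ↦ -sys.gradTuple K)
    (fun _ hK ↦ (h.contDiffAt_gradTuple hK).neg.contDiffWithinAt) fun _ hK ↦ h.gradField_eq hK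

omit hK in
theorem contDiffOn_gaussNewtonField : ContDiffOn ℝ 1 sys.gaussNewtonField sys.stabilizing :=
  ContDiffOn.congr (f := fun K ↦ Gain.ofMat fun i ↦ (-2 : ℝ) • sys.newtonMat K i)
    (fun K hK ↦ (Gain.contDiffAt_ofMat fun i a b ↦ by
      simp only [Matrix.smul_apply, smul_eq_mul, newtonMat]
      exact contDiffAt_const.mul (ContDiffAt.matrix_mul_apply
        (ContDiffAt.matrix_inv_apply (h.contDiffAt_psi hK i) (h.psi_posDef hK i).isUnit)
        (h.contDiffAt_lMat hK i) a b)).contDiffWithinAt)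
    fun _ hK ↦ gaussNewtonField_eq

omit hK in
theorem contDiffOn_natGradField : ContDiffOn ℝ 1 sys.natGradField sys.stabilizing :=
  ContDiffOn.congr (f := fun K ↦ Gain.ofMat fun i ↦ (-2 : ℝ) • sys.lMat K i)
    (fun K hK ↦ (Gain.contDiffAt_ofMat fun i a b ↦ by
      simp only [Matrix.smul_apply, smul_eq_mul]
      exact contDiffAt_const.mul (h.contDiffAt_lMat hK i a b)).contDiffWithinAt)
    fun _ hK ↦ h.natGradField_eq hK

theorem inner_gradTuple_gaussNewtonField : inner ℝ (sys.gradTuple K) (sys.gaussNewtonField K) =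
    -(4 * sys.aggregate K (sys.newtonDecrement K)) := by
  rw [h.inner_gradTuple hK, gaussNewtonField_eq, ← neg_mul, ← smul_eq_mul, ← map_smul]
  congr 1
  ext1 i
  rw [Gain.mat_ofMat, Pi.smul_apply, Matrix.transpose_smul, Matrix.smul_mul, Matrix.mul_smul,
    ← h.newtonDecrement_eq hK, ← h.newtonDecrement_eq' hK, ← add_smul]
  norm_num

theorem inner_gradTuple_ofMat_lMat (c : ℝ) :
    inner ℝ (sys.gradTuple K) (Gain.ofMat fun i ↦ c • sys.lMat K i) =
      2 * c * sys.aggregate K fun i ↦ (sys.lMat K i)ᵀ * sys.lMat K i := by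
  rw [h.inner_gradTuple hK, ← smul_eq_mul, ← map_smul]
  congr 1
  ext1 i
  rw [Gain.mat_ofMat, Pi.smul_apply, Matrix.transpose_smul, Matrix.smul_mul, Matrix.mul_smul,
    ← add_smul, two_mul]

omit hK in
/-- Gradient dominance: along each of the three flows the suboptimality decays at a rate that is
uniform on the set of stabilizing gains. -/
theorem exists_decay_rate {K' : Gain d k N} (hK' : K' ∈ sys.stabilizing)
    {F : Gain d k N → Gain d k N}
    (hF : F ∈ ({sys.gradField, sys.gaussNewtonField, sys.natGradField} :
      Set (Gain d k N → Gain d k N))) :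
    ∃ c : ℝ, 0 < c ∧ ∀ K ∈ sys.stabilizing,
      inner ℝ (sys.gradTuple K) (F K) ≤ -(c * (sys.costReal K - sys.costReal K')) := by
  obtain ⟨x, hx, hxV⟩ := h.exists_initPairing_lower
  obtain ⟨r, hr, hrR⟩ := exists_uniform_sub_smul_one h.R_pos
  -- The `+ 1` keeps the divisor positive even if the aggregate vanishes, as for `d = 0`.
  set y : ℝ := sys.aggregate K' 1 + 1 with hy
  have hy0 : 0 < y := add_pos_of_nonneg_of_pos (h.aggregate_nonneg hK' PsdFamily.one) one_pos
  have hN : ∀ K ∈ sys.stabilizing, (sys.costReal K - sys.costReal K') / y ≤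
      ∑ i, (sys.newtonDecrement K i).trace := fun K hK ↦ by
    have h1 : 0 ≤ ∑ i, (sys.newtonDecrement K i).trace :=
      Finset.sum_nonneg fun i _ ↦ (h.newtonDecrement_psd hK i).trace_nonneg
    rw [div_le_iff₀ hy0, hy, mul_add, mul_one]
    exact (h.costReal_sub_le hK hK').trans (le_add_of_nonneg_right h1)
  have hL : ∀ K ∈ sys.stabilizing, r * ((sys.costReal K - sys.costReal K') / y) ≤
      ∑ i, ((sys.lMat K i)ᵀ * sys.lMat K i).trace := fun K hK ↦ by
    refine (mul_le_mul_of_nonneg_left (hN K hK) hr.le).trans ?_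
    rw [Finset.mul_sum]
    exact Finset.sum_le_sum fun i _ ↦ h.trace_newtonDecrement_le hK hr hrR i
  have hLx : ∀ K ∈ sys.stabilizing, x * ∑ i, ((sys.lMat K i)ᵀ * sys.lMat K i).trace ≤
      sys.aggregate K fun i ↦ (sys.lMat K i)ᵀ * sys.lMat K i := fun K hK ↦ by
    have hpsd : PsdFamily fun i ↦ (sys.lMat K i)ᵀ * sys.lMat K i :=
      fun i ↦ Matrix.posSemidef_transpose_mul_self _
    exact (hxV _ hpsd).trans (h.initPairing_le_aggregate hK hpsd)
  simp only [mem_insert_iff, mem_singleton_iff] at hF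
  rcases hF with rfl | rfl | rfl
  · refine ⟨4 * x ^ 2 * r / y, by positivity, fun K hK ↦ ?_⟩
    rw [h.gradField_eq hK, inner_neg_right, real_inner_self_eq_norm_sq, neg_le_neg_iff]
    set ℓ : Gain d k N := Gain.ofMat (sys.lMat K) with hℓ
    have h1 : ‖ℓ‖ ^ 2 = ∑ i, ((sys.lMat K i)ᵀ * sys.lMat K i).trace := Gain.norm_sq_eq _
    -- Pairing the gradient 2L𝐗 with L gives at least 2x‖L‖²; Cauchy–Schwarz turns this into a lower
    -- bound for the norm of the gradient.
    have h2 : 2 * x * ‖ℓ‖ ^ 2 ≤ ‖sys.gradTuple K‖ * ‖ℓ‖ := by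
      have h3 := h.inner_gradTuple_ofMat_lMat hK 1
      simp only [one_smul, mul_one] at h3
      refine le_trans ?_ ((le_of_eq h3.symm).trans (real_inner_le_norm _ _))
      rw [h1, mul_assoc]
      exact mul_le_mul_of_nonneg_left (hLx K hK) two_pos.le
    have h4 : 2 * x * ‖ℓ‖ ≤ ‖sys.gradTuple K‖ := by
      rcases (norm_nonneg ℓ).eq_or_lt with h0 | h0
      · rw [← h0, mul_zero]; exact norm_nonneg _
      · refine le_of_mul_le_mul_right ?_ h0
        rwa [mul_assoc, ← pow_two]
    have h5 : (2 * x * ‖ℓ‖) ^ 2 ≤ ‖sys.gradTuple K‖ ^ 2 :=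
      pow_le_pow_left₀ (by positivity) h4 2
    refine le_trans ?_ h5
    have h6 := hL K hK
    rw [← h1] at h6
    have h7 := mul_le_mul_of_nonneg_left h6 (show 0 ≤ 4 * x ^ 2 by positivity)
    calc _ = 4 * x ^ 2 * (r * ((sys.costReal K - sys.costReal K') / y)) := by ring
      _ ≤ _ := h7
      _ = _ := by ring
  · refine ⟨4 * x / y, by positivity, fun K hK ↦ ?_⟩
    rw [h.inner_gradTuple_gaussNewtonField hK, neg_le_neg_iff]
    have h1 := (hxV _ (h.newtonDecrement_psd hK)).trans
      (h.initPairing_le_aggregate hK (h.newtonDecrement_psd hK))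
    have h2 := mul_le_mul_of_nonneg_left (hN K hK) hx.le
    calc _ = 4 * (x * ((sys.costReal K - sys.costReal K') / y)) := by ring
      _ ≤ _ := by linarith
  · refine ⟨4 * x * r / y, by positivity, fun K hK ↦ ?_⟩
    rw [h.natGradField_eq hK, h.inner_gradTuple_ofMat_lMat hK]
    have h2 := mul_le_mul_of_nonneg_left (hL K hK) hx.le
    have h3 := hLx K hK
    have h4 : 4 * x * r / y * (sys.costReal K - sys.costReal K') =
      4 * (x * (r * ((sys.costReal K - sys.costReal K') / y))) := by ring
    rw [h4]
    linarith

omit hK in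
/-- If `P = W + ℒ(P)` with `q ≤ W` and `P ≤ β`, then the powers of `ℒ` decay geometrically. -/
theorem lyapLin_pow_one_le {P : Fin N → Matrix (Fin d) (Fin d) ℝ} {q β : ℝ} (hq : 0 < q)
    (hqβ : q ≤ β) (hQ : ∀ i, (sys.Q i - q • (1 : Matrix (Fin d) (Fin d) ℝ)).PosSemidef)
    (hP : PsdFamily P) (hPβ : PsdFamily (β • 1 - P)) (K : Gain d k N)
    (hfix : P = sys.runCost K + sys.lyapOp K P) (t : ℕ) (i : Fin N) (a : Fin d) :
    (sys.lyapLin K ^ t) (1 : Fin N → Matrix (Fin d) (Fin d) ℝ) i a a ≤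
      β / q * (1 - q / β) ^ t := by
  have hβ : 0 < β := hq.trans_le hqβ
  set ρ := 1 - q / β with hρ
  have hρ0 : 0 ≤ ρ := sub_nonneg.2 ((div_le_one hβ).2 hqβ)
  have hp := h.chain.p_nonneg
  have h1 : PsdFamily (P - q • 1) := by
    have : P - q • 1 = (sys.runCost K - q • 1) + sys.lyapOp K P := by
      conv_lhs => rw [hfix]
      abel
    rw [this]
    exact (h.runCost_sub_psd hQ K).add (sys.lyapOp_psd hp K hP)
  -- One step contracts `P`: ℒ(P) = P - W ≤ P - q ≤ (1 - q/β) P, where W is the running cost and the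
  -- last inequality uses P ≤ β.
  have h2 : PsdFamily (ρ • P - sys.lyapLin K P) := by
    have h3 : sys.lyapLin K P = P - sys.runCost K := by
      rw [lyapLin_apply, eq_sub_iff_add_eq, add_comm]; exact hfix.symm
    have : ρ • P - sys.lyapLin K P = (sys.runCost K - q • 1) + (q / β) • (β • 1 - P) := by
      rw [h3, hρ, sub_smul, one_smul, smul_sub, smul_smul, div_mul_cancel₀ _ hβ.ne']
      abel
    rw [this]
    exact (h.runCost_sub_psd hQ K).add (hPβ.smul (by positivity))
  have h4 : ∀ t : ℕ, PsdFamily (ρ ^ t • P - (sys.lyapLin K ^ t) P) := by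
    intro t
    induction t with
    | zero => simpa using PsdFamily.zero
    | succ t ih =>
      have : ρ ^ (t + 1) • P - (sys.lyapLin K ^ (t + 1)) P =
          ρ ^ t • (ρ • P - sys.lyapLin K P) +
            sys.lyapLin K (ρ ^ t • P - (sys.lyapLin K ^ t) P) := by
        rw [map_sub, map_smul, pow_succ, smul_sub, smul_smul, pow_succ', Module.End.mul_apply]
        abel
      rw [this]
      exact (h2.smul (pow_nonneg hρ0 t)).add (sys.lyapOp_psd hp K ih)
  -- The chain is q ℒᵗ(1) ≤ ℒᵗ(P) ≤ ρᵗ P ≤ β ρᵗ.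
  have h5 : PsdFamily ((β * ρ ^ t) • 1 - q • (sys.lyapLin K ^ t) 1) := by
    have : (β * ρ ^ t) • 1 - q • (sys.lyapLin K ^ t) 1 = ρ ^ t • (β • 1 - P) +
        (ρ ^ t • P - (sys.lyapLin K ^ t) P) + (sys.lyapLin K ^ t) (P - q • 1) := by
      rw [map_sub, map_smul, smul_sub, smul_smul, mul_comm β]
      abel
    rw [this]
    exact ((hPβ.smul (pow_nonneg hρ0 t)).add (h4 t)).add (sys.lyapLin_pow_psd hp K t h1)
  have h6 := (h5 i).diag_nonneg (i := a)
  simp only [Pi.sub_apply, Pi.smul_apply, Pi.one_apply, Matrix.sub_apply, Matrix.smul_apply,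
    Matrix.one_apply_eq, smul_eq_mul, mul_one, sub_nonneg] at h6
  rw [div_mul_eq_mul_div, le_div_iff₀ hq, mul_comm]
  exact h6

omit hK in
theorem mem_stabilizing_of_bound {q β : ℝ} (hq : 0 < q) (hqβ : q ≤ β) (hb : ∀ (t : ℕ) i a,
    (sys.lyapLin K ^ t) (1 : Fin N → Matrix (Fin d) (Fin d) ℝ) i a a ≤
      β / q * (1 - q / β) ^ t) : K ∈ sys.stabilizing := by
  have hβ : 0 < β := hq.trans_le hqβ
  refine h.mem_stabilizing_of_tendsto_diag h.π_pos fun i a ↦ ?_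
  have h1 : Tendsto (fun t : ℕ ↦ β / q * (1 - q / β) ^ t) atTop (𝓝 (β / q * 0)) :=
    (tendsto_pow_atTop_nhds_zero_of_lt_one (sub_nonneg.2 ((div_le_one hβ).2 hqβ))
      (sub_lt_self _ (by positivity))).const_mul _
  rw [mul_zero] at h1
  exact squeeze_zero (fun t ↦ (sys.lyapLin_pow_psd h.chain.p_nonneg K t PsdFamily.one i).diag_nonneg)
    (fun t ↦ hb t i a) h1

omit hK in
-- The danger is a limit of stabilizing gains that is not stabilizing. A bound on the cost bounds
-- the value matrices, hence gives one geometric decay estimate for all gains in the sublevel set;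
-- this estimate is a closed condition and itself implies stability. Boundedness holds because the
-- input cost alone is at least x r ‖K‖².
theorem isCompact_sublevel (α : ℝ) :
    IsCompact {K | K ∈ sys.stabilizing ∧ sys.costReal K ≤ α} := by
  obtain ⟨x, hx, hxV⟩ := h.exists_initPairing_lower
  obtain ⟨r, hr, hrR⟩ := exists_uniform_sub_smul_one h.R_pos
  obtain ⟨q, hq, hqQ⟩ := exists_uniform_sub_smul_one h.Q_pos
  -- Here α / x bounds the traces of the value matrices; the maximum guarantees `q ≤ β`, so that the
  -- ratio 1 - q/β is nonnegative.
  set β : ℝ := max q (α / x) with hβ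
  set Z : Set (Gain d k N) := {K | ∀ (t : ℕ) i a,
    (sys.lyapLin K ^ t) (1 : Fin N → Matrix (Fin d) (Fin d) ℝ) i a a ≤
      β / q * (1 - q / β) ^ t} with hZ
  have hZS : Z ⊆ sys.stabilizing := fun K hK ↦ h.mem_stabilizing_of_bound hq (le_max_left _ _) hK
  have hZc : IsClosed Z := by
    have : Z = ⋂ (t : ℕ) (i : Fin N) (a : Fin d), {K |
        (sys.lyapLin K ^ t) (1 : Fin N → Matrix (Fin d) (Fin d) ℝ) i a a ≤
          β / q * (1 - q / β) ^ t} := by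
      ext K; simp [hZ]
    rw [this]
    refine isClosed_iInter fun t ↦ isClosed_iInter fun i ↦ isClosed_iInter fun a ↦
      isClosed_le ?_ continuous_const
    have h1 : Continuous fun K ↦ (sys.lyapCLM K ^ t) (familyEquiv d N 1) :=
      ((sys.contDiff_lyapCLM (n := 0)).continuous.pow t).clm_apply continuous_const
    have h2 : Continuous fun K ↦ (sys.lyapCLM K ^ t) (familyEquiv d N 1) i a a :=
      (continuous_apply a).comp ((continuous_apply a).comp ((continuous_apply i).comp h1))
    simpa only [lyapCLM_pow_apply, familyEquiv_apply] using! h2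
  have hsub : {K | K ∈ sys.stabilizing ∧ sys.costReal K ≤ α} = Z ∩ sys.costReal ⁻¹' Iic α := by
    ext K
    refine ⟨fun ⟨hK, hα⟩ ↦ ⟨?_, hα⟩, fun ⟨hK, hα⟩ ↦ ⟨hZS hK, hα⟩⟩
    have h1 : ∀ i, (sys.valueMat K i).trace ≤ β := fun i ↦ by
      have h2 := (hxV _ (h.valueMat_psd hK)).trans_eq (h.costReal_eq_initPairing hK).symm
      refine ((h.valueMat_psd hK).trace_le_sum i).trans ((le_div_iff₀' hx).2 (h2.trans hα) |>.trans (le_max_right _ _))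
    exact h.lyapLin_pow_one_le hq (le_max_left _ _) hqQ (h.valueMat_psd hK)
      ((h.valueMat_psd hK).smul_one_sub h1) K (h.valueMat_eq hK)
  refine Metric.isCompact_of_isClosed_isBounded ?_ ?_
  · rw [hsub]
    exact ContinuousOn.preimage_isClosed_of_isClosed (fun K hK ↦
      (h.contDiffAt_costReal (hZS hK) (n := 0)).continuousAt.continuousWithinAt) hZc isClosed_Iic
  · refine (Metric.isBounded_closedBall (x := (0 : Gain d k N))
      (r := Real.sqrt (α / (x * r)))).subset fun K ⟨hK, hα⟩ ↦ ?_
    rw [mem_closedBall_zero_iff]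
    refine Real.le_sqrt_of_sq_le ?_
    have h1 : PsdFamily fun i ↦ (K.mat i)ᵀ * sys.R i * K.mat i :=
      fun i ↦ (h.R_pos i).posSemidef.transpose_mul_mul _
    have h2 : x * (r * ‖K‖ ^ 2) ≤ sys.aggregate K fun i ↦ (K.mat i)ᵀ * sys.R i * K.mat i := by
      refine le_trans (mul_le_mul_of_nonneg_left ?_ hx.le)
        ((hxV _ h1).trans (h.initPairing_le_aggregate hK h1))
      rw [Gain.norm_sq_eq, Finset.mul_sum]
      exact Finset.sum_le_sum fun i _ ↦ Matrix.trace_mul_le_of_sub_posSemidef (hrR i) _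
    have h3 : sys.costReal K = sys.aggregate K sys.Q +
        sys.aggregate K fun i ↦ (K.mat i)ᵀ * sys.R i * K.mat i := by
      rw [h.costReal_eq hK, ← map_add]; rfl
    have h4 := h.aggregate_nonneg hK (V := sys.Q) fun i ↦ (h.Q_pos i).posSemidef
    rw [le_div_iff₀ (by positivity)]
    linarith

end Regular

end MJLS

end

/-! ### Riccati solutions, the optimal gain and convergence of the flows -/

noncomputable section

/-- The closed-loop cost-to-go in terms of the residual `(R + Bᵀ E B) K - Bᵀ E A`. -/
theorem closedLoop_quadratic_eq {d k : ℕ} (A E : Matrix (Fin d) (Fin d) ℝ)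
    (B : Matrix (Fin d) (Fin k) ℝ) (R : Matrix (Fin k) (Fin k) ℝ) (K : Matrix (Fin k) (Fin d) ℝ) :
    Kᵀ * R * K + (A - B * K)ᵀ * E * (A - B * K) =
      Aᵀ * E * A - Aᵀ * E * B * K + Kᵀ * ((R + Bᵀ * E * B) * K - Bᵀ * E * A) := by
  simp only [Matrix.transpose_sub, Matrix.transpose_mul, Matrix.mul_add, Matrix.add_mul,
    Matrix.mul_sub, Matrix.sub_mul, Matrix.mul_assoc]
  abel

namespace MJLS

variable {d k N : ℕ} {S : Type*} [MeasurableSpace S] {sys : MJLS d k N S}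

namespace Regular

variable (h : sys.Regular)
include h

theorem valueMat_posDef {K : Gain d k N} (hK : K ∈ sys.stabilizing) (i : Fin N) :
    (sys.valueMat K i).PosDef := by
  rw [h.valueMat_eq hK, Pi.add_apply, runCost, add_assoc]
  exact (h.Q_pos i).add_posSemidef (((h.R_pos i).posSemidef.transpose_mul_mul _).add
    (sys.lyapOp_psd h.chain.p_nonneg K (h.valueMat_psd hK) i))

theorem isUnit_psi_det {P : Fin N → Matrix (Fin d) (Fin d) ℝ} (hP : PsdFamily P) (i : Fin N) :
    IsUnit (sys.psi P i).det :=
  (Matrix.isUnit_iff_isUnit_det _).1 ((h.R_pos i).add_posSemidef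
    ((sys.expOp_posSemidef h.chain.p_nonneg hP i).transpose_mul_mul _)).isUnit

theorem riccatiGain_valueMat {K : Gain d k N} (hK : K ∈ sys.stabilizing)
    (hL : ∀ i, sys.lMat K i = 0) : sys.riccatiGain (sys.valueMat K) = K := by
  refine Gain.mat_injective fun i ↦ ?_
  rw [riccatiGain, Gain.mat_ofMat, ← sub_eq_zero.1 (hL i)]
  exact Matrix.nonsing_inv_mul_cancel_left _ _ (h.isUnit_psi_det (h.valueMat_psd hK) i)

theorem isRiccatiSolution_valueMat {K : Gain d k N} (hK : K ∈ sys.stabilizing)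
    (hL : ∀ i, sys.lMat K i = 0) : sys.IsRiccatiSolution (sys.valueMat K) := by
  refine ⟨h.valueMat_posDef hK, fun i ↦ ?_⟩
  have h1 : K.mat i = (sys.psi (sys.valueMat K) i)⁻¹ *
      ((sys.B i)ᵀ * sys.expOp (sys.valueMat K) i * sys.A i) := by
    conv_lhs => rw [← h.riccatiGain_valueMat hK hL]
    rfl
  have h2 := closedLoop_quadratic_eq (sys.A i) (sys.expOp (sys.valueMat K) i) (sys.B i) (sys.R i)
    (K.mat i)
  have h3 : (sys.R i + (sys.B i)ᵀ * sys.expOp (sys.valueMat K) i * sys.B i) * K.mat i -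
      (sys.B i)ᵀ * sys.expOp (sys.valueMat K) i * sys.A i = 0 := hL i
  rw [h3, Matrix.mul_zero, add_zero] at h2
  rw [Matrix.mul_assoc _ (sys.psi (sys.valueMat K) i)⁻¹, ← h1, add_sub_assoc, ← h2, ← add_assoc]
  exact congrFun (h.valueMat_eq hK) i

section Riccati

variable {P : Fin N → Matrix (Fin d) (Fin d) ℝ} (hP : sys.IsRiccatiSolution P)
include hP

theorem riccatiGain_residual (i : Fin N) :
    sys.psi P i * (sys.riccatiGain P).mat i - (sys.B i)ᵀ * sys.expOp P i * sys.A i = 0 := by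
  rw [riccatiGain, Gain.mat_ofMat, Matrix.mul_nonsing_inv_cancel_left _ _
    (h.isUnit_psi_det (fun j ↦ (hP.1 j).posSemidef) i), sub_self]

/-- The Riccati gain makes the residual ΨK - BᵀℰA vanish, and then the closed-loop quadratic form
collapses to the right side of the Riccati equation. -/
theorem riccati_fixedPoint :
    P = sys.runCost (sys.riccatiGain P) + sys.lyapOp (sys.riccatiGain P) P := by
  ext1 i
  have h2 := closedLoop_quadratic_eq (sys.A i) (sys.expOp P i) (sys.B i) (sys.R i)
    ((sys.riccatiGain P).mat i)
  have h3 : (sys.R i + (sys.B i)ᵀ * sys.expOp P i * sys.B i) * (sys.riccatiGain P).mat i -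
      (sys.B i)ᵀ * sys.expOp P i * sys.A i = 0 := h.riccatiGain_residual hP i
  rw [h3, Matrix.mul_zero, add_zero] at h2
  rw [Pi.add_apply, runCost, lyapOp, closedLoop, add_assoc, h2, riccatiGain, Gain.mat_ofMat,
    ← Matrix.mul_assoc _ (sys.psi P i)⁻¹, ← add_sub_assoc]
  exact hP.2 i

/-- `P` serves as a Lyapunov function: the running cost is bounded below by a positive multiple of
the identity, which forces geometric decay of ℒᵗ(1). -/
theorem riccatiGain_mem : sys.riccatiGain P ∈ sys.stabilizing := by
  obtain ⟨q, hq, hqQ⟩ := exists_uniform_sub_smul_one h.Q_pos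
  have hPs : PsdFamily P := fun i ↦ (hP.1 i).posSemidef
  exact h.mem_stabilizing_of_bound hq (le_max_left q (∑ i, (P i).trace))
    (h.lyapLin_pow_one_le hq (le_max_left _ _) hqQ hPs
      (hPs.smul_one_sub fun i ↦ (hPs.trace_le_sum i).trans (le_max_right _ _)) _
      (h.riccati_fixedPoint hP))

/-- The resolvent inverts P ↦ P - ℒ(P). Hence a Riccati solution is determined by its gain, and its
uniqueness reduces to that of stationary gains. -/
theorem valueMat_riccatiGain : sys.valueMat (sys.riccatiGain P) = P := by
  rw [h.valueMat_eq_resolvent (h.riccatiGain_mem hP), eq_sub_of_add_eq (h.riccati_fixedPoint hP).symm]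
  exact h.resolvent_sub_lyapOp h.π_pos (h.riccatiGain_mem hP) P

theorem lMat_riccatiGain (i : Fin N) : sys.lMat (sys.riccatiGain P) i = 0 := by
  rw [lMat, h.valueMat_riccatiGain hP]
  exact h.riccatiGain_residual hP i

end Riccati

/-- Quadratic growth of the cost around a stationary gain. -/
theorem exists_quadratic_growth : ∃ m : ℝ, 0 < m ∧ ∀ K' ∈ sys.stabilizing,
    (∀ i, sys.lMat K' i = 0) → ∀ K ∈ sys.stabilizing,
      m * ‖K - K'‖ ^ 2 ≤ sys.costReal K - sys.costReal K' := by
  obtain ⟨x, hx, hxV⟩ := h.exists_initPairing_lower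
  obtain ⟨r, hr, hrR⟩ := exists_uniform_sub_smul_one h.R_pos
  refine ⟨x * r, mul_pos hx hr, fun K' hK' hL K hK ↦ ?_⟩
  rw [h.costReal_sub hK' hK]
  -- At a stationary gain the linear terms vanish; the remaining quadratic form is bounded below
  -- through Ψ ≥ R ≥ r.
  have h1 : (sys.increment K' fun i ↦ K.mat i - K'.mat i) = fun i ↦
      ((K - K').mat i)ᵀ * sys.psi (sys.valueMat K') i * (K - K').mat i := by
    ext1 i
    rw [increment, hL, Gain.mat_sub]
    simp
  have h2 : PsdFamily fun i ↦
      ((K - K').mat i)ᵀ * sys.psi (sys.valueMat K') i * (K - K').mat i :=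
    fun i ↦ (h.psi_posDef hK' i).posSemidef.transpose_mul_mul _
  rw [h1, mul_assoc, Gain.norm_sq_eq, Finset.mul_sum]
  refine le_trans (mul_le_mul_of_nonneg_left ?_ hx.le)
    ((hxV _ h2).trans (h.initPairing_le_aggregate hK h2))
  exact Finset.sum_le_sum fun i _ ↦
    Matrix.trace_mul_le_of_sub_posSemidef (h.psi_sub_psd hK' hrR i) _

/-- A minimizer over a compact sublevel set is a local minimizer, as the stabilizing set is open.
The gradient 2L𝐗 vanishes there, and 𝐗 is invertible. -/
theorem exists_stationary (hne : sys.stabilizing.Nonempty) :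
    ∃ K ∈ sys.stabilizing, ∀ i, sys.lMat K i = 0 := by
  obtain ⟨K₀, hK₀⟩ := hne
  obtain ⟨K, ⟨hK, hKα⟩, hmin⟩ := (h.isCompact_sublevel (sys.costReal K₀)).exists_isMinOn
    ⟨K₀, hK₀, le_rfl⟩ (f := sys.costReal)
    fun K hK ↦ (h.contDiffAt_costReal hK.1 (n := 0)).continuousAt.continuousWithinAt
  refine ⟨K, hK, fun i ↦ ?_⟩
  have hloc : IsLocalMin sys.costReal K := by
    filter_upwards [h.eventually_mem hK] with K' hK'
    -- Nearby gains outside the sublevel set cost at least C(K₀), hence at least as much as the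
    -- minimizer.
    rcases le_total (sys.costReal K') (sys.costReal K₀) with hle | hle
    · exact hmin ⟨hK', hle⟩
    · exact hKα.trans hle
  have h1 := hloc.hasFDerivAt_eq_zero (h.hasGradientAt_costReal hK).hasFDerivAt
  have h2 : sys.gradTuple K = 0 := by simpa using h1
  have h3 : (2 : ℝ) • (sys.lMat K i * sys.corrMat K i) = 0 := congrArg (fun K ↦ Gain.mat K i) h2
  have h4 := (smul_eq_zero.1 h3).resolve_left two_ne_zero
  rw [← Matrix.mul_nonsing_inv_cancel_right (sys.corrMat K i) (sys.lMat K i)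
    ((Matrix.isUnit_iff_isUnit_det _).1 (h.corrMat_posDef hK i).isUnit), h4, Matrix.zero_mul]

theorem costReal_lt {K K' : Gain d k N} (hK' : K' ∈ sys.stabilizing)
    (hL : ∀ i, sys.lMat K' i = 0) (hK : K ∈ sys.stabilizing) (hne : K ≠ K') :
    sys.costReal K' < sys.costReal K := by
  obtain ⟨m, hm, hgrow⟩ := h.exists_quadratic_growth
  have h1 := hgrow K' hK' hL K hK
  have h2 : 0 < ‖K - K'‖ := norm_pos_iff.2 (sub_ne_zero.2 hne)
  have h3 : 0 < m * ‖K - K'‖ ^ 2 := by positivity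
  linarith

theorem costReal_le {K K' : Gain d k N} (hK' : K' ∈ sys.stabilizing)
    (hL : ∀ i, sys.lMat K' i = 0) (hK : K ∈ sys.stabilizing) :
    sys.costReal K' ≤ sys.costReal K := by
  rcases eq_or_ne K K' with rfl | hne
  · exact le_rfl
  · exact (h.costReal_lt hK' hL hK hne).le

/-- Each of two distinct stationary gains would be strictly cheaper than the other. -/
theorem stationary_unique {K K' : Gain d k N} (hK : K ∈ sys.stabilizing)
    (hL : ∀ i, sys.lMat K i = 0) (hK' : K' ∈ sys.stabilizing) (hL' : ∀ i, sys.lMat K' i = 0) :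
    K = K' := by
  by_contra hne
  exact lt_asymm (h.costReal_lt hK' hL' hK hne) (h.costReal_lt hK hL hK' (Ne.symm hne))

theorem existsUnique_riccati (hne : sys.stabilizing.Nonempty) :
    ∃! P, sys.IsRiccatiSolution P := by
  obtain ⟨K, hK, hL⟩ := h.exists_stationary hne
  refine ⟨sys.valueMat K, h.isRiccatiSolution_valueMat hK hL, fun P hP ↦ ?_⟩
  rw [← h.valueMat_riccatiGain hP, h.stationary_unique (h.riccatiGain_mem hP)
    (h.lMat_riccatiGain hP) hK hL]

theorem contDiffOn_field {F : Gain d k N → Gain d k N}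
    (hF : F ∈ ({sys.gradField, sys.gaussNewtonField, sys.natGradField} :
      Set (Gain d k N → Gain d k N))) : ContDiffOn ℝ 1 F sys.stabilizing := by
  simp only [mem_insert_iff, mem_singleton_iff] at hF
  rcases hF with rfl | rfl | rfl
  · exact h.contDiffOn_gradField
  · exact h.contDiffOn_gaussNewtonField
  · exact h.contDiffOn_natGradField

theorem exists_exponential_flow {Kstar : Gain d k N} (hKs : Kstar ∈ sys.stabilizing)
    (hL : ∀ i, sys.lMat Kstar i = 0) {F : Gain d k N → Gain d k N}
    (hF : F ∈ ({sys.gradField, sys.gaussNewtonField, sys.natGradField} :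
      Set (Gain d k N → Gain d k N))) :
    ∃ c : ℝ, 0 < c ∧ ∀ K₀ ∈ sys.stabilizing, ∃ φ : ℝ → Gain d k N,
      sys.IsTrajectory F K₀ (Set.Ici 0) φ ∧
      (∀ T : ℝ, 0 < T → ∀ ψ : ℝ → Gain d k N, sys.IsTrajectory F K₀ (Set.Ico 0 T) ψ →
        Set.EqOn ψ φ (Set.Ico 0 T)) ∧
      (∀ t : ℝ, 0 ≤ t → sys.costReal (φ t) - sys.costReal Kstar ≤
        Real.exp (-(c * t)) * (sys.costReal K₀ - sys.costReal Kstar)) ∧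
      ∃ M : ℝ, ∀ t : ℝ, 0 ≤ t → ‖φ t - Kstar‖ ≤ M * Real.exp (-(c * t)) := by
  obtain ⟨c, hc, hdecay⟩ := h.exists_decay_rate hKs hF
  obtain ⟨m, hm, hgrow⟩ := h.exists_quadratic_growth
  -- Quadratic growth controls the square of the distance by the cost gap, so the distance decays at
  -- half the rate of the cost. Both estimates are claimed with the same rate, hence `c / 2`.
  refine ⟨c / 2, half_pos hc, fun K₀ hK₀ ↦ ?_⟩
  obtain ⟨φ, hφ0, hφ, huniq, hcost⟩ := exists_trajectory_of_decay (h.isOpen_stabilizing h.π_pos)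
    (h.contDiffOn_field hF) hc.le (fun K hK ↦ (h.hasGradientAt_costReal hK).hasFDerivAt)
    (fun K hK ↦ h.costReal_le hKs hL hK) (fun K hK ↦ hdecay K hK) h.isCompact_sublevel hK₀
  have hgap : 0 ≤ sys.costReal K₀ - sys.costReal Kstar := sub_nonneg.2 (h.costReal_le hKs hL hK₀)
  refine ⟨φ, ⟨hφ0, hφ⟩, fun T hT ψ hψ ↦ huniq T hT ψ hψ.1 hψ.2, fun t ht ↦ ?_,
    Real.sqrt ((sys.costReal K₀ - sys.costReal Kstar) / m), fun t ht ↦ ?_⟩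
  · refine (hcost t ht).trans (mul_le_mul_of_nonneg_right (Real.exp_le_exp.2 ?_) hgap)
    nlinarith
  · have h1 := (hgrow Kstar hKs hL (φ t) (hφ t ht).1).trans (hcost t ht)
    have h2 : Real.exp (-(c * t)) = Real.exp (-(c / 2 * t)) ^ 2 := by
      rw [← Real.exp_nat_mul]; congr 1; push_cast; ring
    refine le_of_sq_le_sq ?_ (by positivity)
    rw [mul_pow, Real.sq_sqrt (by positivity), ← h2, div_mul_eq_mul_div, le_div_iff₀' hm,
      mul_comm _ (Real.exp _)]
    exact h1

end Regular

end MJLS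

end

theorem mainTheorem6 {d k N : ℕ} {S : Type*} [MeasurableSpace S] (sys : MJLS d k N S)
    (hprob : IsProbabilityMeasure sys.Pr)
    (hchain : IsMarkovChain sys.Pr sys.ω sys.p sys.π₀)
    (hx₀ : Measurable sys.x₀)
    (hx₀_sq : ∀ a, MemLp (fun s => sys.x₀ s a) 2 sys.Pr)
    (hindep : IndepFun sys.x₀ (fun s t => sys.ω t s) sys.Pr)
    (hQ : ∀ i, (sys.Q i).PosDef) (hR : ∀ i, (sys.R i).PosDef)
    (hπ : ∀ i, 0 < sys.π₀ i)
    (hcov : (secondMoment sys.Pr sys.x₀).PosDef)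
    (hstab : sys.stabilizing.Nonempty) :
    (∃! P, sys.IsRiccatiSolution P) ∧
    ∀ P, sys.IsRiccatiSolution P → ∀ Kstar, Kstar = sys.riccatiGain P →
      Kstar ∈ sys.stabilizing ∧
      (∀ K ∈ sys.stabilizing, K ≠ Kstar → sys.cost Kstar < sys.cost K) ∧
      ∀ F ∈ ({sys.gradField, sys.gaussNewtonField, sys.natGradField} :
          Set (Gain d k N → Gain d k N)),
        ∃ c : ℝ, 0 < c ∧ ∀ K₀ ∈ sys.stabilizing, ∃ φ : ℝ → Gain d k N,
          sys.IsTrajectory F K₀ (Set.Ici 0) φ ∧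
          (∀ T : ℝ, 0 < T → ∀ ψ : ℝ → Gain d k N, sys.IsTrajectory F K₀ (Set.Ico 0 T) ψ →
            Set.EqOn ψ φ (Set.Ico 0 T)) ∧
          (∀ t : ℝ, 0 ≤ t → sys.costReal (φ t) - sys.costReal Kstar ≤
            Real.exp (-(c * t)) * (sys.costReal K₀ - sys.costReal Kstar)) ∧
          ∃ M : ℝ, ∀ t : ℝ, 0 ≤ t → ‖φ t - Kstar‖ ≤ M * Real.exp (-(c * t)) := by
  have h : sys.Regular := ⟨⟨hprob, hchain, hx₀, hx₀_sq, hindep⟩, hQ, hR, hπ, hcov⟩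
  refine ⟨h.existsUnique_riccati hstab, fun P hP Kstar hKstar ↦ ?_⟩
  subst hKstar
  have hmem := h.riccatiGain_mem hP
  have hL := h.lMat_riccatiGain hP
  refine ⟨hmem, fun K hK hne ↦ ?_, fun F hF ↦ h.exists_exponential_flow hmem hL hF⟩
  have hlt := h.costReal_lt hmem hL hK hne
  -- Both extended costs are finite on the stabilizing set, so the strict inequality between real
  -- costs transfers.
  rw [h.cost_eq hmem, h.cost_eq hK, ← h.costReal_eq hmem, ← h.costReal_eq hK]
  exact (ENNReal.ofReal_lt_ofReal_iff_of_nonneg ENNReal.toReal_nonneg).2 hlt
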